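/- Let $d\ge1$ be an integer, let $p\ge1$ be real with $d<6p$, and let $T>0$. For $t>0$ and $x,y\in\mathbb R^d$ let $$K_{t;x,y}=(2\pi)^{-d}\int_{\mathbb R^d}e^{-\frac t8(-2+|\xi|^2)^2}\cos(\langle\xi,x-y\rangle)\,d\xi$$ be the L-KS kernel, the fundamental solution of $\partial_t u=-\tfrac18(\Delta+2)^2u$. Let $u_0\in L^{2p}(\mathbb R^d;\mathbb R)$, and let $I\subset[0,\infty)$ be an interval containing $0$. An L-KS (mild) solution in $C(I;L^{2p}(\mathbb R^d;\mathbb R))$ of the Kuramoto–Sivashinsky–Burgers equation $$\partial_tU=-\tfrac18(\Delta^2+4\Delta)U-\tfrac12\sum_{k=1}^d\partial_kU^2,\qquad U(0,\cdot)=u_0,$$ is a continuous function $U:I\to L^{2p}(\mathbb R^d;\mathbb R)$ with $U(0)=u_0$ such that for every $t\in I$, $t>0$, and almost every $x\in\mathbb R^d$ the following integrals converge and $$U(t,x)=\int_{\mathbb R^d}K_{t;x,y}u_0(y)\,dy+\frac12\int_0^t\!\int_{\mathbb R^d}K_{t-s;x,y}U(s,y)\,dy\,ds+\frac12\sum_{\ell=1}^d\int_0^t\!\int_{\mathbb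 R^d}\frac{\partial K_{t-s;x,y}}{\partial y_\ell}U(s,y)^2\,dy\,ds .$$ Then: 1. (Local existence and uniqueness.) There are a time $\tau\in(0,T]$ and an L-KS solution $U\in C([0,\tau];L^{2p}(\mathbb R^d;\mathbb R))$, and it is the only L-KS solution in $C([0,\tau];L^{2p}(\mathbb R^d;\mathbb R))$ with initial value $u_0$. In particular there is an L-KS solution in $C([0,\tau_\infty);L^{2p}(\mathbb R^d;\mathbb R))$ for some $\tau_\infty\in(0,T]$. 2. (Global uniqueness.) If $U_1,U_2\in C([0,T];L^{2p}(\mathbb R^d;\mathbb R))$ are L-KS solutions with initial value $u_0$, then $U_1(t)=U_2(t)$ for all $t\in[0,T]$. -/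

import Mathlib

open MeasureTheory

noncomputable section

namespace KSB

/-- For a real exponent `p ≥ 1` the Lebesgue exponent `2p` is at least `1`, so that
`L^{2p}` is a Banach space. -/
instance fact_one_le_two_mul (p : ℝ) [h : Fact (1 ≤ p)] :
    Fact (1 ≤ ENNReal.ofReal (2 * p)) :=
  ⟨by
    have h1 : (1 : ℝ) ≤ p := h.out
    rw [← ENNReal.ofReal_one]
    exact ENNReal.ofReal_le_ofReal (by linarith)⟩

/-- The space `L^{2p}(ℝ^d; ℝ)` with Lebesgue measure. -/
abbrev L2p (d : ℕ) (p : ℝ) : Type :=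
  Lp ℝ (ENNReal.ofReal (2 * p)) (volume : Measure (EuclideanSpace ℝ (Fin d)))

/-- The L-KS kernel in its Fourier form,
`K_{t;x,y} = (2π)^{-d} ∫ exp(-(t/8) (-2 + |ξ|²)²) cos ⟨ξ, x - y⟩ dξ`, for `t > 0`. -/
def lksKernel (d : ℕ) (t : ℝ) (x y : EuclideanSpace ℝ (Fin d)) : ℝ :=
  ((2 * Real.pi) ^ d)⁻¹ *
    ∫ ξ : EuclideanSpace ℝ (Fin d),
      Real.exp (-(t / 8) * (-2 + ‖ξ‖ ^ 2) ^ 2) * Real.cos (inner ℝ ξ (x - y))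

/-- The partial derivative `∂ K_{t;x,y} / ∂ y_ℓ` of the L-KS kernel. -/
def lksKernelDeriv (d : ℕ) (l : Fin d) (t : ℝ) (x y : EuclideanSpace ℝ (Fin d)) : ℝ :=
  lineDeriv ℝ (fun z => lksKernel d t x z) y (EuclideanSpace.single l (1 : ℝ))

/-- The iterated integral `∫_0^t ∫_{ℝ^d} f(s, y) dy ds` converges: the inner integrals are
(Lebesgue) convergent for `0 < s < t`, and so is the outer one. -/
def IteratedIntegrable {d : ℕ} (t : ℝ) (f : ℝ → EuclideanSpace ℝ (Fin d) → ℝ) : Prop :=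
  (∀ s ∈ Set.Ioo 0 t, Integrable (f s)) ∧
    IntervalIntegrable (fun s => ∫ y, f s y) volume 0 t

/-- `U` is an L-KS (mild) solution, on the time interval `I` and in `C(I; L^{2p})`, of
`∂ₜ U = -(1/8) (Δ² + 4Δ) U - (1/2) ∑ ∂ₖ U²`, `U(0) = u₀`:
`t ↦ U(t)` is continuous from `I` to `L^{2p}`, `U(0) = u₀`, and for every `t ∈ I` with `t > 0`,
for almost every `x`, all integrals below converge and
`U(t,x) = ∫ K_{t;x,y} u₀(y) dy + (1/2) ∫_0^t ∫ K_{t-s;x,y} U(s,y) dy ds`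
`+ (1/2) ∑_ℓ ∫_0^t ∫ ∂_{y_ℓ} K_{t-s;x,y} U(s,y)² dy ds`. -/
structure IsLKSSolutionOn {d : ℕ} {p : ℝ} [Fact (1 ≤ p)] (I : Set ℝ) (u₀ : L2p d p)
    (U : ℝ → L2p d p) : Prop where
  continuousOn : ContinuousOn U I
  initial : U 0 = u₀
  mild : ∀ t ∈ I, 0 < t → ∀ᵐ x : EuclideanSpace ℝ (Fin d),
    Integrable (fun y => lksKernel d t x y * u₀ y) ∧
    IteratedIntegrable t (fun s y => lksKernel d (t - s) x y * U s y) ∧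
    (∀ l : Fin d, IteratedIntegrable t (fun s y => lksKernelDeriv d l (t - s) x y * U s y ^ 2)) ∧
    U t x = (∫ y, lksKernel d t x y * u₀ y)
      + 1 / 2 * (∫ s in (0 : ℝ)..t, ∫ y, lksKernel d (t - s) x y * U s y)
      + 1 / 2 * ∑ l : Fin d,
          ∫ s in (0 : ℝ)..t, ∫ y, lksKernelDeriv d l (t - s) x y * U s y ^ 2

end KSB

end

open MeasureTheory Filter Topology
open scoped SchwartzMap FourierTransform LineDeriv ENNReal

noncomputable section

namespace KSB

section

/-! ### A continuous family of Schwartz functions -/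

/-! Since -(1/8)(Δ² + 4Δ) = -(1/8)(Δ + 2)² + 1/2, the mild formula is a Volterra equation in
`L^{2p}`, U(t) = P_t u₀ + ∫₀ᵗ Ψ(t - s, U(s)) ds, where P_t is convolution with the L-KS kernel and
Ψ(t, u) is half of P_t u plus half of the sum over ℓ of the convolutions of ∂K_t/∂y_ℓ with u².

The substitution ξ = t^{-1/4} η turns the symbol into exp(-(|η|² - 2√t)²/8). This is a Schwartz
function depending continuously on a = √t in the Schwartz topology, down to a = 0. Hence K_t is a
rescaling by 2π t^{1/4} of a profile with decay uniform for bounded t. Two facts follow: P_t is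
strongly continuous on `L^{2p}` with P_0 = id (`continuous_propagator`, `propagator_zero`), and the
L^a norm of the kernel derivative is O(t^{(d/a - d - 1)/4}) (`exists_eLpNorm_kernelDerivDiff_le`).

As u² lies in L^p, Young's inequality with 1/a = 1 - 1/(2p) maps it back to L^{2p} at the cost
t^{-(1 + d/(2p))/4}, which is integrable at 0 exactly when d < 6p. So Ψ is Lipschitz on bounded sets
with an integrable weight in time. A contraction on a short interval gives existence
(`exists_volterra`), and an exponentially weighted sup norm gives uniqueness on any interval
(`eqOn_of_volterra`).

The mild formula is pointwise with iterated integrals, while the Volterra equation uses a Bochner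
integral in `L^{2p}`. `ae_coeFn_integral_Lp` and the joint continuity of the inner convolutions
identify the two (`ae_duhamel`). -/

theorem exists_bound_pow_mul_exp (m : ℕ) :
    ∃ C : ℝ, ∀ s : ℝ, |s| ^ m * Real.exp (-s ^ 2 / 8) ≤ C := by
  refine ⟨1 + 8 ^ m * m.factorial, fun s => ?_⟩
  have h1 : |s| ^ m ≤ 1 + (s ^ 2) ^ m := by
    rcases le_total (|s|) 1 with h | h
    · have := pow_le_one₀ (n := m) (abs_nonneg s) h
      have : 0 ≤ (s ^ 2) ^ m := by positivity
      linarith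
    · have : |s| ≤ s ^ 2 := by nlinarith [sq_abs s]
      have := pow_le_pow_left₀ (abs_nonneg s) this m
      linarith
  have h2 : (s ^ 2) ^ m ≤ 8 ^ m * m.factorial * Real.exp (s ^ 2 / 8) := by
    have := Real.pow_div_factorial_le_exp (s ^ 2 / 8) (by positivity) m
    rw [div_le_iff₀ (by positivity), div_pow, div_le_iff₀ (by positivity)] at this
    linarith
  have h3 : Real.exp (s ^ 2 / 8) * Real.exp (-s ^ 2 / 8) = 1 := by
    rw [← Real.exp_add]; simp [neg_div]
  have h4 : Real.exp (-s ^ 2 / 8) ≤ 1 := by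
    rw [Real.exp_le_one_iff]; nlinarith [sq_nonneg s]
  calc |s| ^ m * Real.exp (-s ^ 2 / 8)
      ≤ (1 + 8 ^ m * m.factorial * Real.exp (s ^ 2 / 8)) * Real.exp (-s ^ 2 / 8) := by
        gcongr; linarith
    _ = Real.exp (-s ^ 2 / 8) + 8 ^ m * m.factorial := by
        rw [add_mul, mul_assoc, h3]; ring
    _ ≤ _ := by linarith

theorem exists_bound_polynomial_mul_exp (P : Polynomial ℝ) :
    ∃ C : ℝ, ∀ s : ℝ, |P.eval s| * Real.exp (-s ^ 2 / 8) ≤ C := by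
  induction P using Polynomial.induction_on' with
  | add P Q hP hQ =>
    obtain ⟨C, hC⟩ := hP
    obtain ⟨D, hD⟩ := hQ
    refine ⟨C + D, fun s => ?_⟩
    rw [Polynomial.eval_add]
    refine le_trans ?_ (add_le_add (hC s) (hD s))
    rw [← add_mul]
    gcongr
    exact abs_add_le _ _
  | monomial n a =>
    obtain ⟨C, hC⟩ := exists_bound_pow_mul_exp n
    refine ⟨|a| * C, fun s => ?_⟩
    rw [Polynomial.eval_monomial, abs_mul, abs_pow, mul_assoc]
    gcongr
    exact hC s

theorem iteratedDeriv_exp_neg_sq (n : ℕ) : ∃ P : Polynomial ℝ, ∀ s : ℝ,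
    iteratedDeriv n (fun s : ℝ => Real.exp (-s ^ 2 / 8)) s = P.eval s * Real.exp (-s ^ 2 / 8) := by
  induction n with
  | zero => exact ⟨1, by simp⟩
  | succ n ih =>
    obtain ⟨P, hP⟩ := ih
    refine ⟨P.derivative - Polynomial.C (1 / 4) * Polynomial.X * P, fun s => ?_⟩
    rw [iteratedDeriv_succ, funext hP]
    have h1 : HasDerivAt (fun s : ℝ => Real.exp (-s ^ 2 / 8))
        (Real.exp (-s ^ 2 / 8) * (-(2 * s) / 8)) s := by
      simpa using (((hasDerivAt_pow 2 s).neg).div_const 8).exp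
    rw [((P.hasDerivAt s).fun_mul h1).deriv]
    simp
    ring

/-- The Gaussian `s ↦ exp (-s² / 8)` as a Schwartz function. -/
def gaussianSchwartz : 𝓢(ℝ, ℝ) where
  toFun s := Real.exp (-s ^ 2 / 8)
  smooth' := by fun_prop
  decay' := by
    intro k n
    obtain ⟨P, hP⟩ := iteratedDeriv_exp_neg_sq n
    obtain ⟨C, hC⟩ := exists_bound_polynomial_mul_exp (Polynomial.X ^ k * P)
    refine ⟨C, fun s => ?_⟩
    rw [norm_iteratedFDeriv_eq_norm_iteratedDeriv, hP]
    refine le_trans (le_of_eq ?_) (hC s)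
    simp [abs_mul, mul_assoc]

/-- Mean value theorem in the shift: the difference costs one more derivative of `g`, and a shift of
size at most `A` changes the weight by the factor (1 + |A|)^k at most. This local Lipschitz bound
makes the symbol continuous in its parameter. -/
theorem seminorm_compSubConst_sub_le (g : 𝓢(ℝ, ℝ)) (k n : ℕ) (A : ℝ) :
    ∃ C : ℝ, 0 ≤ C ∧ ∀ a b : ℝ, |a| ≤ A → |b| ≤ A →
      SchwartzMap.seminorm ℝ k n (g.compSubConstCLM ℝ a - g.compSubConstCLM ℝ b) ≤
        C * |a - b| := by
  set S : ℝ := 2 ^ k *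
    (Finset.Iic (k, n + 1)).sup (fun m => SchwartzMap.seminorm ℝ m.1 m.2) g with hS
  have hS0 : 0 ≤ S := by positivity
  have key : ∀ x : ℝ, (1 + |x|) ^ k * |iteratedDeriv (n + 1) g x| ≤ S := by
    intro x
    have := SchwartzMap.one_add_le_sup_seminorm_apply (𝕜 := ℝ) (m := (k, n + 1)) (k := k)
      (n := n + 1) le_rfl le_rfl g x
    rwa [norm_iteratedFDeriv_eq_norm_iteratedDeriv, Real.norm_eq_abs] at this
  refine ⟨(1 + |A|) ^ k * S, by positivity, fun a b ha hb => ?_⟩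
  refine SchwartzMap.seminorm_le_bound' ℝ k n _ (by positivity) fun x => ?_
  have hcd : ∀ c : ℝ, ContDiff ℝ n (g.compSubConstCLM ℝ c) := fun c => (SchwartzMap.smooth _ _)
  have hit : ∀ c : ℝ, iteratedDeriv n (g.compSubConstCLM ℝ c) x = iteratedDeriv n g (x - c) := by
    intro c
    have : (g.compSubConstCLM ℝ c : ℝ → ℝ) = fun z => g (z - c) := by ext; simp
    rw [this, iteratedDeriv_comp_sub_const]
  have hco : ⇑(g.compSubConstCLM ℝ a - g.compSubConstCLM ℝ b)
      = ⇑(g.compSubConstCLM ℝ a) - ⇑(g.compSubConstCLM ℝ b) := rfl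
  rw [hco, iteratedDeriv_sub (hcd a).contDiffAt (hcd b).contDiffAt, hit, hit]
  have hdiff : ∀ y, HasDerivAt (iteratedDeriv n g) (iteratedDeriv (n + 1) g y) y := by
    intro y
    rw [iteratedDeriv_succ]
    exact (((g.smooth (n + 1 : ℕ)).differentiable_iteratedDeriv n (by norm_cast; omega)) y).hasDerivAt
  set B : ℝ := (1 + |A|) ^ k * S
  have hmv : |x| ^ k * |iteratedDeriv n g (x - a) - iteratedDeriv n g (x - b)| ≤ B * |a - b| := by
    have hd : ∀ c ∈ Set.uIcc b a, HasDerivWithinAt (fun c => |x| ^ k * iteratedDeriv n g (x - c))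
        (|x| ^ k * (iteratedDeriv (n + 1) g (x - c) * (-1))) (Set.uIcc b a) c := by
      intro c _
      have h := (hdiff (x - c)).comp c ((hasDerivAt_id c).const_sub x)
      exact (h.const_mul (|x| ^ k)).hasDerivWithinAt
    have hbd : ∀ c ∈ Set.uIcc b a, ‖|x| ^ k * (iteratedDeriv (n + 1) g (x - c) * (-1))‖ ≤ B := by
      intro c hc
      have hcA : |c| ≤ A := by
        rw [abs_le] at ha hb ⊢
        rcases Set.mem_uIcc.1 hc with h | h <;> constructor <;> linarith
      have hx : |x| ≤ (1 + |A|) * (1 + |x - c|) := by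
        have h1 : |x| ≤ |x - c| + |c| := by simpa using abs_add_le (x - c) c
        have h2 := le_abs_self A
        have h3 := mul_nonneg (abs_nonneg A) (abs_nonneg (x - c))
        nlinarith
      have h4 := pow_le_pow_left₀ (abs_nonneg x) hx k
      rw [mul_pow] at h4
      rw [norm_mul, norm_pow, norm_mul]
      simp only [Real.norm_eq_abs, abs_abs, norm_neg, norm_one, mul_one]
      calc |x| ^ k * |iteratedDeriv (n + 1) g (x - c)|
          ≤ ((1 + |A|) ^ k * (1 + |x - c|) ^ k) * |iteratedDeriv (n + 1) g (x - c)| := by gcongr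
        _ = (1 + |A|) ^ k * ((1 + |x - c|) ^ k * |iteratedDeriv (n + 1) g (x - c)|) := by ring
        _ ≤ B := by
          exact mul_le_mul_of_nonneg_left (key _) (by positivity)
    have := (convex_uIcc b a).norm_image_sub_le_of_norm_hasDerivWithin_le hd hbd
      Set.left_mem_uIcc Set.right_mem_uIcc
    rw [← mul_sub, norm_mul] at this
    simpa using this
  exact hmv

theorem continuous_compSubConst (g : 𝓢(ℝ, ℝ)) :
    Continuous fun a : ℝ => g.compSubConstCLM ℝ a := by
  rw [continuous_iff_continuousAt]
  intro a
  rw [ContinuousAt, (schwartz_withSeminorms ℝ ℝ ℝ).tendsto_nhds _ _]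
  rintro ⟨k, n⟩ ε hε
  obtain ⟨C, hC0, hC⟩ := seminorm_compSubConst_sub_le g k n (|a| + 1)
  have h1 : ∀ᶠ b in 𝓝 a, C * |b - a| < ε := by
    have : Tendsto (fun b => C * |b - a|) (𝓝 a) (𝓝 (C * |a - a|)) :=
      Continuous.tendsto (by fun_prop) a
    simp only [sub_self, abs_zero, mul_zero] at this
    exact this.eventually (gt_mem_nhds hε)
  filter_upwards [h1, Metric.ball_mem_nhds a one_pos] with b hb hb'
  refine lt_of_le_of_lt (hC b a ?_ (by linarith)) hb
  rw [Metric.mem_ball, Real.dist_eq] at hb'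
  have : |b| ≤ |b - a| + |a| := by simpa using abs_add_le (b - a) a
  linarith

variable (d : ℕ)

/-- Composition of a Schwartz function on the line with `η ↦ ‖η‖²`. -/
def compNormSqCLM : 𝓢(ℝ, ℂ) →L[ℝ] 𝓢(EuclideanSpace ℝ (Fin d), ℂ) :=
  SchwartzMap.compCLM ℝ (g := fun η : EuclideanSpace ℝ (Fin d) => ‖η‖ ^ 2)
    (Function.hasTemperateGrowth_norm_sq _) ⟨1, 1, fun x => by
      simp only [norm_pow, norm_norm, pow_one, one_mul]
      nlinarith [sq_nonneg (‖x‖ - 1), norm_nonneg x]⟩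

/-- The rescaled Fourier symbol `η ↦ exp (-(‖η‖² - 2a)² / 8)` of the L-KS kernel. -/
def symbol (a : ℝ) : 𝓢(EuclideanSpace ℝ (Fin d), ℂ) :=
  compNormSqCLM d (SchwartzMap.postcompCLM Complex.ofRealCLM
    (gaussianSchwartz.compSubConstCLM ℝ (2 * a)))

theorem symbol_apply (a : ℝ) (η : EuclideanSpace ℝ (Fin d)) :
    symbol d a η = ((Real.exp (-(‖η‖ ^ 2 - 2 * a) ^ 2 / 8) : ℝ) : ℂ) := rfl

theorem continuous_symbol : Continuous (symbol d) :=
  (compNormSqCLM d).continuous.comp ((SchwartzMap.postcompCLM _).continuous.comp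
    ((continuous_compSubConst gaussianSchwartz).comp (by fun_prop)))

/-- The rescaled kernel, the Fourier transform of `symbol`. -/
def profile (a : ℝ) : 𝓢(EuclideanSpace ℝ (Fin d), ℂ) := 𝓕 (symbol d a)

theorem continuous_profile : Continuous (profile d) :=
  (FourierTransform.fourierCLM ℂ 𝓢(EuclideanSpace ℝ (Fin d), ℂ)).continuous.comp
    (continuous_symbol d)

end

/-! ### The L-KS kernel as a rescaled Schwartz profile -/

section

theorem continuous_uncurry_of_continuous_schwartz {X V F : Type*} [TopologicalSpace X]
    [NormedAddCommGroup V] [NormedSpace ℝ V] [NormedAddCommGroup F] [NormedSpace ℝ F]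
    {f : X → 𝓢(V, F)} (hf : Continuous f) :
    Continuous fun z : X × V => f z.1 z.2 := by
  have h : Continuous fun x => SchwartzMap.toBoundedContinuousFunctionCLM ℝ V F (f x) :=
    (SchwartzMap.toBoundedContinuousFunctionCLM ℝ V F).continuous.comp hf
  exact (h.comp continuous_fst).eval continuous_snd

/-- Schwartz seminorms are continuous, hence bounded on compact parameter sets. Applied to √t in [0,
√T], this gives kernel bounds uniform up to t = 0. -/
theorem exists_decay_of_continuous_schwartz {X V F : Type*} [TopologicalSpace X]
    [NormedAddCommGroup V] [NormedSpace ℝ V] [NormedAddCommGroup F] [NormedSpace ℝ F]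
    {f : X → 𝓢(V, F)} (hf : Continuous f) {S : Set X} (hS : IsCompact S) (k : ℕ) :
    ∃ C : ℝ, 0 ≤ C ∧ ∀ x ∈ S, ∀ v, ‖f x v‖ ≤ C * ((1 + ‖v‖) ^ k)⁻¹ := by
  have h : Continuous fun x =>
      ((Finset.Iic (k, 0)).sup (fun m => SchwartzMap.seminorm ℝ m.1 m.2) : Seminorm ℝ 𝓢(V, F))
        (f x) := by
    exact (Seminorm.continuous_finsetSup fun i _ =>
      (schwartz_withSeminorms ℝ V F).continuous_seminorm i).comp hf
  obtain ⟨C, hC⟩ := hS.exists_bound_of_continuousOn h.continuousOn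
  refine ⟨2 ^ k * |C|, by positivity, fun x hx v => ?_⟩
  have h1 := SchwartzMap.one_add_le_sup_seminorm_apply (𝕜 := ℝ) (m := (k, 0)) (k := k)
      (n := 0) le_rfl le_rfl (f x) v
  rw [norm_iteratedFDeriv_zero] at h1
  have h2 := (le_abs_self _).trans ((hC x hx).trans (le_abs_self C))
  rw [← div_eq_mul_inv, le_div_iff₀ (by positivity), mul_comm]
  refine h1.trans ?_
  exact mul_le_mul_of_nonneg_left h2 (by positivity)

variable (d : ℕ)

theorem continuous_profile_deriv (m : EuclideanSpace ℝ (Fin d)) :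
    Continuous fun a => ∂_{m} (profile d a) :=
  (LineDeriv.lineDerivOpCLM ℝ 𝓢(EuclideanSpace ℝ (Fin d), ℂ) m).continuous.comp (continuous_profile d)

/-- Fourier inversion at the origin: the mass of the profile is the symbol at 0, namely exp(-a²/2).
It equals 1 at a = 0, which makes the propagator the identity at time 0. -/
theorem integral_profile_zero : ∫ w, profile d 0 w = 1 := by
  have h : 𝓕⁻ (profile d 0) 0 = symbol d 0 0 := by
    rw [profile, FourierTransform.fourierInv_fourier_eq]
  rw [SchwartzMap.fourierInv_coe, Real.fourierInv_eq, symbol_apply] at h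
  simpa using h

theorem re_profile (a : ℝ) (w : EuclideanSpace ℝ (Fin d)) :
    (profile d a w).re = ∫ v : EuclideanSpace ℝ (Fin d),
      Real.exp (-(‖v‖ ^ 2 - 2 * a) ^ 2 / 8) * Real.cos (2 * Real.pi * inner ℝ v w) := by
  have h0 : profile d a w = 𝓕 (symbol d a : EuclideanSpace ℝ (Fin d) → ℂ) w := rfl
  rw [h0, Real.fourier_eq, ← RCLike.re_to_complex, ← integral_re]
  · refine integral_congr_ae (ae_of_all _ fun v => ?_)
    simp only [symbol_apply, Circle.smul_def, Real.fourierChar_apply, smul_eq_mul,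
      RCLike.re_to_complex]
    rw [mul_comm, Complex.re_ofReal_mul, Complex.exp_ofReal_mul_I_re]
    congr 1
    rw [← Real.cos_neg]
    congr 1
    ring
  · exact (Real.fourierIntegral_convergent_iff' (innerSL ℝ) w).2 (symbol d a).integrable

/-- The length scale of the L-KS kernel at time `t`. -/
def scale (t : ℝ) : ℝ := 2 * Real.pi * t ^ (1 / 4 : ℝ)

theorem scale_pos {t : ℝ} (ht : 0 < t) : 0 < scale t := by
  unfold scale; positivity

theorem continuous_scale : Continuous scale := by
  unfold scale
  exact continuous_const.mul (Real.continuous_rpow_const (by norm_num))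

/-- The L-KS kernel as a function of the difference variable. -/
def kernelDiff (t : ℝ) (z : EuclideanSpace ℝ (Fin d)) : ℝ :=
  ((scale t) ^ d)⁻¹ * (profile d √t ((scale t)⁻¹ • z)).re

/-- The derivative in `y_ℓ` of the L-KS kernel as a function of the difference variable. -/
def kernelDerivDiff (l : Fin d) (t : ℝ) (z : EuclideanSpace ℝ (Fin d)) : ℝ :=
  -(((scale t) ^ (d + 1))⁻¹ *
    ((∂_{EuclideanSpace.single l (1 : ℝ)} (profile d √t)) ((scale t)⁻¹ • z)).re)

/-- Substitute ξ = t^{-1/4} v, under which t(|ξ|² - 2)² = (|v|² - 2√t)². The 2π in `scale` converts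
the phase ⟨ξ, x - y⟩ to the normalization exp(-2πi⟨v, w⟩) of `𝓕`, and its d-th power is the
prefactor. -/
theorem lksKernel_eq {t : ℝ} (ht : 0 < t) (x y : EuclideanSpace ℝ (Fin d)) :
    lksKernel d t x y = kernelDiff d t (x - y) := by
  have hb : 0 < t ^ (1 / 4 : ℝ) := by positivity
  have hb2 : (t ^ (1 / 4 : ℝ)) ^ 2 = √t := by
    rw [← Real.rpow_natCast, ← Real.rpow_mul ht.le, Real.sqrt_eq_rpow]; norm_num
  have hs : √t ^ 2 = t := Real.sq_sqrt ht.le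
  have hspos : 0 < √t := Real.sqrt_pos.2 ht
  rw [lksKernel, kernelDiff, re_profile, scale]
  generalize t ^ (1 / 4 : ℝ) = b at *
  have h := Measure.integral_comp_smul (volume : Measure (EuclideanSpace ℝ (Fin d)))
    (fun ξ => Real.exp (-(t / 8) * (-2 + ‖ξ‖ ^ 2) ^ 2) * Real.cos (inner ℝ ξ (x - y))) b⁻¹
  rw [finrank_euclideanSpace_fin, smul_eq_mul, abs_of_pos (by positivity)] at h
  have h2 : (b⁻¹ ^ d)⁻¹ = b ^ d := by simp
  rw [h2] at h
  rw [mul_pow (2 * Real.pi) b, mul_inv, mul_assoc]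
  congr 1
  rw [← inv_mul_cancel_left₀ (pow_pos hb d).ne' (∫ ξ : EuclideanSpace ℝ (Fin d), _), ← h]
  congr 1
  refine integral_congr_ae (ae_of_all _ fun v => ?_)
  simp only [norm_smul, inner_smul_left, inner_smul_right, norm_inv, Real.norm_eq_abs,
    abs_of_pos hb]
  congr 2
  · rw [mul_pow, inv_pow, hb2]
    generalize √t = a at *
    rw [← hs]
    field_simp
    ring
  · simp
    field_simp

theorem lksKernelDeriv_eq {t : ℝ} (ht : 0 < t) (l : Fin d) (x y : EuclideanSpace ℝ (Fin d)) :
    lksKernelDeriv d l t x y = kernelDerivDiff d l t (x - y) := by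
  have hs := scale_pos ht
  unfold lksKernelDeriv kernelDerivDiff
  simp_rw [lksKernel_eq d ht, kernelDiff]
  set e := EuclideanSpace.single l (1 : ℝ)
  have h1 : HasFDerivAt (fun z : EuclideanSpace ℝ (Fin d) => (scale t)⁻¹ • (x - z))
      ((scale t)⁻¹ • (-ContinuousLinearMap.id ℝ (EuclideanSpace ℝ (Fin d)))) y := by
    exact ((hasFDerivAt_id (𝕜 := ℝ) y).const_sub x).const_smul (scale t)⁻¹
  have h2 := (profile d √t).hasFDerivAt ((scale t)⁻¹ • (x - y))
  have h3 := Complex.reCLM.hasFDerivAt.comp y (h2.comp y h1)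
  have h4 := (h3.const_mul ((scale t ^ d)⁻¹)).hasLineDerivAt e
  replace h4 := h4.lineDeriv
  rw [SchwartzMap.lineDerivOp_apply_eq_fderiv]
  simp only [Function.comp_def, Complex.reCLM_apply] at h4
  rw [h4]
  simp
  field_simp
  ring

end

/-! ### Kernel families with integrable decay and their convolution integrals -/

section

/-- The space `L^b(ℝ^d; ℝ)` with Lebesgue measure. -/
abbrev LpV (d : ℕ) (b : ℝ≥0∞) : Type :=
  Lp ℝ b (volume : Measure (EuclideanSpace ℝ (Fin d)))

theorem exists_integral_abs_mul_le {X : Type*} [MeasurableSpace X] {μ : Measure X} {q b : ℝ≥0∞}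
    [ENNReal.HolderConjugate q b] {W : X → ℝ} (hW : MemLp W q μ) :
    ∃ C, 0 ≤ C ∧ ∀ h : Lp ℝ b μ, ∫ y, |W y * h y| ∂μ ≤ C * ‖h‖ := by
  have : Fact (1 ≤ b) := ⟨ENNReal.HolderConjugate.one_le b q⟩
  have : Fact (1 ≤ q) := ⟨ENNReal.HolderConjugate.one_le q b⟩
  set L := (ContinuousLinearMap.mul ℝ ℝ).lpPairing μ q b hW.norm.toLp
  refine ⟨‖L‖, norm_nonneg _, fun h => ?_⟩
  have h1 : ∫ y, |W y * h y| ∂μ = L |h| := by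
    rw [ContinuousLinearMap.lpPairing_eq_integral]
    refine integral_congr_ae ?_
    filter_upwards [hW.norm.coeFn_toLp, Lp.coeFn_abs h] with y h2 h3
    rw [h2, h3, abs_mul]
    rfl
  rw [h1, ← norm_abs_eq_norm h]
  exact (le_abs_self _).trans (L.le_opNorm _)

variable {d : ℕ}

/-- The decay profile `z ↦ (1 + ‖z‖)^{-(d+1)}`. -/
def decayWeight (z : EuclideanSpace ℝ (Fin d)) : ℝ := ((1 + ‖z‖) ^ (d + 1))⁻¹

theorem decayWeight_nonneg (z : EuclideanSpace ℝ (Fin d)) : 0 ≤ decayWeight z := by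
  unfold decayWeight; positivity

theorem decayWeight_le_one (z : EuclideanSpace ℝ (Fin d)) : decayWeight z ≤ 1 := by
  unfold decayWeight
  exact inv_le_one_of_one_le₀ (one_le_pow₀ (by linarith [norm_nonneg z]))

theorem continuous_decayWeight : Continuous (decayWeight (d := d)) := by
  unfold decayWeight
  refine Continuous.inv₀ (by fun_prop) fun z => by positivity

theorem integrable_decayWeight : Integrable (decayWeight (d := d)) := by
  have h := integrable_one_add_norm (E := EuclideanSpace ℝ (Fin d)) (μ := volume)
    (r := (d : ℝ) + 1) (by simp)
  refine h.congr (ae_of_all _ fun z => ?_)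
  simp only [decayWeight]
  rw [Real.rpow_neg (by positivity), ← Real.rpow_natCast]
  push_cast
  rfl

theorem memLp_decayWeight {q : ℝ≥0∞} (hq : 1 ≤ q) : MemLp (decayWeight (d := d)) q := by
  have hm := (continuous_decayWeight (d := d)).aestronglyMeasurable (μ := volume)
  rcases eq_or_ne q ∞ with rfl | hq'
  · exact memLp_top_of_bound hm 1 (ae_of_all _ fun z => by
      rw [Real.norm_of_nonneg (decayWeight_nonneg z)]; exact decayWeight_le_one z)
  rw [← integrable_norm_rpow_iff hm (by positivity) hq']
  refine integrable_decayWeight.mono (hm.norm.aemeasurable.pow_const _).aestronglyMeasurable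
    (ae_of_all _ fun z => ?_)
  have h1 : 1 ≤ q.toReal := by
    rw [← ENNReal.toReal_one]; exact (ENNReal.toReal_le_toReal (by simp) hq').2 hq
  simp only [Real.norm_of_nonneg (decayWeight_nonneg z)]
  rw [Real.norm_of_nonneg (Real.rpow_nonneg (decayWeight_nonneg z) _)]
  exact Real.rpow_le_self_of_le_one (decayWeight_nonneg z) (decayWeight_le_one z) h1

/-- A Peetre-type inequality, 1 + ‖y‖ ≤ (1 + ‖x‖)(1 + ‖x - y‖). It lets a single multiple of
`decayWeight y` dominate the kernel for all `x` in a bounded set. -/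
theorem decayWeight_sub_le (x y : EuclideanSpace ℝ (Fin d)) :
    decayWeight (x - y) ≤ (1 + ‖x‖) ^ (d + 1) * decayWeight y := by
  unfold decayWeight
  rw [← div_eq_mul_inv, le_div_iff₀ (by positivity), inv_mul_le_iff₀ (by positivity), ← mul_pow]
  refine pow_le_pow_left₀ (by positivity) ?_ _
  have h1 : ‖y‖ ≤ ‖x‖ + ‖x - y‖ := by
    have := norm_sub_le x (x - y); simpa using this
  have := mul_nonneg (norm_nonneg x) (norm_nonneg (x - y))
  nlinarith

/-- A family of convolution kernels indexed by `t > 0`, jointly continuous and with locally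
uniform integrable decay. -/
structure IsKernelFamily (k : ℝ → EuclideanSpace ℝ (Fin d) → ℝ) : Prop where
  cont : ContinuousOn (fun z : ℝ × EuclideanSpace ℝ (Fin d) => k z.1 z.2)
    (Set.Ioi 0 ×ˢ Set.univ)
  decay : ∀ t₀ > 0, ∃ C, 0 ≤ C ∧ ∀ᶠ t in 𝓝 t₀, ∀ z, |k t z| ≤ C * decayWeight z

theorem decayWeight_inv_smul_le {δ : ℝ} (hδ : 0 < δ) (z : EuclideanSpace ℝ (Fin d)) :
    decayWeight (δ⁻¹ • z) ≤ (1 + δ) ^ (d + 1) * decayWeight z := by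
  unfold decayWeight
  rw [← div_eq_mul_inv, le_div_iff₀ (by positivity), inv_mul_le_iff₀ (by positivity), ← mul_pow]
  refine pow_le_pow_left₀ (by positivity) ?_ _
  rw [norm_smul, norm_inv, Real.norm_of_nonneg hδ.le]
  have : (1 + δ⁻¹ * ‖z‖) * (1 + δ) = 1 + ‖z‖ + δ + δ⁻¹ * ‖z‖ := by field_simp; ring
  rw [this]
  have := norm_nonneg z
  have : 0 ≤ δ⁻¹ * ‖z‖ := by positivity
  linarith

theorem isKernelFamily_of_continuous {f : ℝ → 𝓢(EuclideanSpace ℝ (Fin d), ℂ)}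
    (hf : Continuous f) {c : ℝ → ℝ} (hc : ContinuousOn c (Set.Ioi 0)) :
    IsKernelFamily fun t z => c t * (f √t ((scale t)⁻¹ • z)).re where
  cont := by
    refine ContinuousOn.mul (hc.comp continuousOn_fst fun z hz => hz.1) ?_
    refine Complex.continuous_re.comp_continuousOn ?_
    refine (continuous_uncurry_of_continuous_schwartz hf).comp_continuousOn
      (f := fun z : ℝ × EuclideanSpace ℝ (Fin d) => (√z.1, (scale z.1)⁻¹ • z.2)) ?_
    refine ContinuousOn.prodMk (by fun_prop) (ContinuousOn.fun_smul ?_ continuousOn_snd)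
    exact ((continuous_scale.comp continuous_fst).continuousOn).inv₀
      fun z hz => (scale_pos hz.1).ne'
  decay := by
    intro t₀ ht₀
    obtain ⟨C, hC0, hC⟩ := exists_decay_of_continuous_schwartz hf
      (isCompact_Icc (a := (0 : ℝ)) (b := √(t₀ + 1))) (d + 1)
    have h1 : ContinuousAt (fun t => |c t| * C * (1 + scale t) ^ (d + 1)) t₀ := by
      refine ContinuousAt.mul (ContinuousAt.mul ?_ continuousAt_const) ?_
      · exact (hc.continuousAt (Ioi_mem_nhds ht₀)).abs
      · exact ((continuous_const.add continuous_scale).pow _).continuousAt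
    refine ⟨|c t₀| * C * (1 + scale t₀) ^ (d + 1) + 1, ?_, ?_⟩
    · have := scale_pos ht₀
      positivity
    · filter_upwards [h1.eventually (gt_mem_nhds (lt_add_one _)), Ioi_mem_nhds ht₀,
        Iio_mem_nhds (lt_add_one t₀)] with t h2 h3 h4 z
      have hs := scale_pos h3
      have h5 := hC √t ⟨Real.sqrt_nonneg _, Real.sqrt_le_sqrt (le_of_lt h4)⟩ ((scale t)⁻¹ • z)
      rw [abs_mul]
      calc |c t| * |(f √t ((scale t)⁻¹ • z)).re|
          ≤ |c t| * (C * decayWeight ((scale t)⁻¹ • z)) := by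
            gcongr
            exact (Complex.abs_re_le_norm _).trans h5
        _ ≤ |c t| * (C * ((1 + scale t) ^ (d + 1) * decayWeight z)) := by
            gcongr
            exact decayWeight_inv_smul_le hs z
        _ = (|c t| * C * (1 + scale t) ^ (d + 1)) * decayWeight z := by ring
        _ ≤ _ := mul_le_mul_of_nonneg_right h2.le (decayWeight_nonneg z)

theorem isKernelFamily_kernelDiff : IsKernelFamily (kernelDiff d) :=
  isKernelFamily_of_continuous (continuous_profile d) (c := fun t => (scale t ^ d)⁻¹)
    ((continuous_scale.pow _).continuousOn.inv₀ fun _ ht => (pow_pos (scale_pos ht) _).ne')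

theorem isKernelFamily_kernelDerivDiff (l : Fin d) : IsKernelFamily (kernelDerivDiff d l) := by
  have := isKernelFamily_of_continuous (continuous_profile_deriv d (EuclideanSpace.single l 1))
    (c := fun t => -(scale t ^ (d + 1))⁻¹)
    ((continuous_scale.pow _).continuousOn.inv₀ fun _ ht => (pow_pos (scale_pos ht) _).ne').neg
  refine (congrArg IsKernelFamily ?_).mp this
  ext t z
  simp only [kernelDerivDiff, neg_mul]

namespace IsKernelFamily

variable {k : ℝ → EuclideanSpace ℝ (Fin d) → ℝ} (hk : IsKernelFamily k)
include hk

theorem exists_bound {t : ℝ} (ht : 0 < t) : ∃ C, 0 ≤ C ∧ ∀ z, |k t z| ≤ C * decayWeight z := by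
  obtain ⟨C, h0, hC⟩ := hk.decay t ht
  exact ⟨C, h0, hC.self_of_nhds⟩

theorem continuous {t : ℝ} (ht : 0 < t) : Continuous (k t) := by
  rw [← continuousOn_univ]
  exact hk.cont.comp (f := fun z => (t, z)) (by fun_prop) fun z _ => ⟨ht, trivial⟩

theorem memLp {t : ℝ} (ht : 0 < t) {q : ℝ≥0∞} (hq : 1 ≤ q) : MemLp (k t) q := by
  obtain ⟨C, h0, hC⟩ := hk.exists_bound ht
  refine ((memLp_decayWeight hq).const_mul C).mono (hk.continuous ht).aestronglyMeasurable
    (ae_of_all _ fun z => ?_)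
  rw [Real.norm_eq_abs, Real.norm_of_nonneg (mul_nonneg h0 (decayWeight_nonneg z))]
  exact hC z

theorem memLp_sub_left {t : ℝ} (ht : 0 < t) {q : ℝ≥0∞} (hq : 1 ≤ q)
    (x : EuclideanSpace ℝ (Fin d)) : MemLp (fun y => k t (x - y)) q :=
  (hk.memLp ht hq).comp_measurePreserving (Measure.measurePreserving_sub_left volume x)

theorem integrable_mul {t : ℝ} (ht : 0 < t) {b : ℝ≥0∞} [hb : Fact (1 ≤ b)]
    (x : EuclideanSpace ℝ (Fin d)) {f : EuclideanSpace ℝ (Fin d) → ℝ} (hf : MemLp f b) :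
    Integrable fun y => k t (x - y) * f y := by
  have : ENNReal.HolderConjugate b b.conjExponent := .conjExponent hb.out
  exact MemLp.integrable_mul (p := b.conjExponent)
    (hk.memLp_sub_left ht (ENNReal.HolderConjugate.one_le b.conjExponent b) x) hf

/-- Joint continuity of `(t, x, f) ↦ ∫ k_t (x - y) f y dy` on `(0, ∞) × ℝᵈ × L^b`. -/
theorem continuousOn_integral {b : ℝ≥0∞} [hb : Fact (1 ≤ b)] :
    ContinuousOn (fun q : ℝ × EuclideanSpace ℝ (Fin d) × LpV d b =>
      ∫ y, k q.1 (q.2.1 - y) * q.2.2 y) (Set.Ioi 0 ×ˢ Set.univ) := by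
  rintro ⟨t₀, x₀, f₀⟩ ⟨ht₀, -⟩
  refine ContinuousAt.continuousWithinAt ?_
  replace ht₀ : 0 < t₀ := ht₀
  have : ENNReal.HolderConjugate b b.conjExponent := .conjExponent hb.out
  have hb1 : 1 ≤ b.conjExponent := ENNReal.HolderConjugate.one_le b.conjExponent b
  obtain ⟨C, hC0, hC⟩ := hk.decay t₀ ht₀
  set W : EuclideanSpace ℝ (Fin d) → ℝ :=
    fun y => C * (1 + (‖x₀‖ + 1)) ^ (d + 1) * decayWeight y with hW
  have hWL : MemLp W b.conjExponent := (memLp_decayWeight hb1).const_mul _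
  have hW0 : ∀ y, 0 ≤ W y := fun y => by
    have := decayWeight_nonneg y
    positivity
  have hev : ∀ᶠ q : ℝ × EuclideanSpace ℝ (Fin d) × LpV d b in 𝓝 (t₀, x₀, f₀),
      0 < q.1 ∧ ∀ y, |k q.1 (q.2.1 - y)| ≤ W y := by
    have h1 := (continuous_fst (X := ℝ) (Y := EuclideanSpace ℝ (Fin d) × LpV d b)).tendsto (t₀, x₀, f₀)
    have h2 := ((continuous_fst.comp continuous_snd).norm).tendsto ((t₀, x₀, f₀) : ℝ × EuclideanSpace ℝ (Fin d) × LpV d b)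
    filter_upwards [h1.eventually hC, h1.eventually (Ioi_mem_nhds ht₀),
      h2.eventually (gt_mem_nhds (lt_add_one _))] with q hq1 hq2 hq3
    refine ⟨hq2, fun y => (hq1 _).trans ?_⟩
    simp only [hW, mul_assoc]
    gcongr
    refine (decayWeight_sub_le _ _).trans ?_
    have := decayWeight_nonneg y
    simp only [Function.comp] at hq3
    gcongr
  -- The function varies only in norm, without a pointwise dominating function. With `f₀` frozen,
  -- dominated convergence handles the kernel, and Hölder against `W` handles the remainder.
  have hsplit : ∀ᶠ q : ℝ × EuclideanSpace ℝ (Fin d) × LpV d b in 𝓝 (t₀, x₀, f₀),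
      ∫ y, k q.1 (q.2.1 - y) * q.2.2 y =
        (∫ y, k q.1 (q.2.1 - y) * f₀ y) + ∫ y, k q.1 (q.2.1 - y) * (q.2.2 - f₀) y := by
    filter_upwards [hev] with q hq
    rw [← integral_add (hk.integrable_mul hq.1 _ (Lp.memLp _)) (hk.integrable_mul hq.1 _ (Lp.memLp _))]
    refine integral_congr_ae ?_
    filter_upwards [Lp.coeFn_sub q.2.2 f₀] with y hy
    rw [hy, Pi.sub_apply]; ring
  rw [ContinuousAt, tendsto_congr' hsplit]
  have hA : Tendsto (fun q : ℝ × EuclideanSpace ℝ (Fin d) × LpV d b => ∫ y, k q.1 (q.2.1 - y) * f₀ y) (𝓝 (t₀, x₀, f₀))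
      (𝓝 (∫ y, k t₀ (x₀ - y) * f₀ y)) := by
    refine tendsto_integral_filter_of_dominated_convergence (fun y => W y * ‖f₀ y‖) ?_ ?_ ?_ ?_
    · filter_upwards [hev] with q hq
      exact (hk.integrable_mul hq.1 _ (Lp.memLp _)).aestronglyMeasurable
    · filter_upwards [hev] with q hq
      refine ae_of_all _ fun y => ?_
      rw [norm_mul]
      exact mul_le_mul_of_nonneg_right (hq.2 y) (norm_nonneg _)
    · exact MemLp.integrable_mul hWL (Lp.memLp f₀).norm
    · refine ae_of_all _ fun y => Tendsto.mul_const _ ?_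
      have h1 : ContinuousAt (fun z : ℝ × EuclideanSpace ℝ (Fin d) => k z.1 z.2) (t₀, x₀ - y) :=
        hk.cont.continuousAt (prod_mem_nhds (Ioi_mem_nhds ht₀) univ_mem)
      refine h1.tendsto.comp (f := fun q : ℝ × EuclideanSpace ℝ (Fin d) × LpV d b => (q.1, q.2.1 - y)) (Continuous.tendsto (by fun_prop) _)
  have hB : Tendsto (fun q : ℝ × EuclideanSpace ℝ (Fin d) × LpV d b => ∫ y, k q.1 (q.2.1 - y) * (q.2.2 - f₀) y)
      (𝓝 (t₀, x₀, f₀)) (𝓝 0) := by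
    obtain ⟨M, hM0, hM⟩ := exists_integral_abs_mul_le (b := b) hWL
    have h1 : Tendsto (fun q : ℝ × EuclideanSpace ℝ (Fin d) × LpV d b => M * ‖q.2.2 - f₀‖)
        (𝓝 (t₀, x₀, f₀)) (𝓝 0) := by
      have : Continuous (fun q : ℝ × EuclideanSpace ℝ (Fin d) × LpV d b => M * ‖q.2.2 - f₀‖) := by
        fun_prop
      simpa using this.tendsto (t₀, x₀, f₀)
    refine squeeze_zero_norm' ?_ h1
    filter_upwards [hev] with q hq
    refine (norm_integral_le_integral_norm _).trans ((integral_mono_of_nonneg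
      (ae_of_all _ fun y => norm_nonneg _) ?_ (ae_of_all _ fun y => ?_)).trans (hM _))
    · exact (MemLp.integrable_mul hWL (Lp.memLp _)).norm
    · simp only [norm_mul, Real.norm_eq_abs, abs_mul, abs_of_nonneg (hW0 y)]
      exact mul_le_mul_of_nonneg_right (hq.2 y) (abs_nonneg _)
  simpa using hA.add hB

end IsKernelFamily

end

section

/-! ### Bochner integrals in `L^r` and pointwise integrals -/

section Bochner

variable {α X : Type*} [MeasurableSpace α] [MeasurableSpace X] {ν : Measure α} {μ : Measure X} {r : ℝ≥0∞} [hr : Fact (1 ≤ r)]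
  {G : α → Lp ℝ r μ} {g : α → X → ℝ}

/-- The indicator of a finite-measure set lies in the conjugate Lebesgue space, so ∫_A |G a| is at
most a constant times ‖G a‖. This supplies the hypothesis of Fubini on ν × A, whereas integrability
over all of `X` may fail. -/
theorem integrable_prod_restrict_of_integrable_Lp [SigmaFinite μ] (hG : Integrable G ν)
    (hg : AEStronglyMeasurable (Function.uncurry g) (ν.prod μ)) (h : ∀ᵐ a ∂ν, G a =ᵐ[μ] g a)
    {A : Set X} (hA : MeasurableSet A) (hA' : μ A < ∞) :
    Integrable (Function.uncurry g) (ν.prod (μ.restrict A)) := by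
  have : ENNReal.HolderConjugate r r.conjExponent := .conjExponent hr.out
  have : Fact (μ A < ∞) := ⟨hA'⟩
  have hgA : AEStronglyMeasurable (Function.uncurry g) (ν.prod (μ.restrict A)) :=
    hg.mono_measure (Measure.prod_mono le_rfl Measure.restrict_le_self)
  have hW : MemLp (A.indicator fun _ => (1 : ℝ)) r.conjExponent μ :=
    memLp_indicator_const _ hA _ (Or.inr hA'.ne)
  obtain ⟨C, hC0, hC⟩ := exists_integral_abs_mul_le (b := r) hW
  rw [integrable_prod_iff hgA]
  constructor
  · filter_upwards [h] with a ha
    have : Integrable (G a) (μ.restrict A) := ((Lp.memLp (G a)).restrict A).integrable hr.out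
    exact this.congr (ae_restrict_of_ae ha)
  · refine (hG.norm.const_mul C).mono hgA.norm.integral_prod_right' ?_
    filter_upwards [h] with a ha
    have h1 : ∫ x, ‖g a x‖ ∂μ.restrict A = ∫ x, |A.indicator (fun _ => (1 : ℝ)) x * G a x| ∂μ := by
      rw [← integral_indicator hA]
      refine integral_congr_ae ?_
      filter_upwards [ha] with x hx
      by_cases hxA : x ∈ A <;> simp [hxA, hx]
    simp only [Function.uncurry]
    rw [h1, Real.norm_of_nonneg (integral_nonneg fun _ => abs_nonneg _),
      Real.norm_of_nonneg (by positivity)]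
    exact hC _

/-- Integration over `A` is a continuous linear functional on L^r, and such functionals commute with
the Bochner integral. -/
theorem setIntegral_integral_Lp (hG : Integrable G ν) {A : Set X} (hA : MeasurableSet A)
    (hA' : μ A < ∞) :
    ∫ x in A, (∫ a, G a ∂ν : Lp ℝ r μ) x ∂μ = ∫ a, ∫ x in A, G a x ∂μ ∂ν := by
  have : ENNReal.HolderConjugate r r.conjExponent := .conjExponent hr.out
  have : Fact (1 ≤ r.conjExponent) := ⟨ENNReal.HolderConjugate.one_le r.conjExponent r⟩
  have hW : MemLp (A.indicator fun _ => (1 : ℝ)) r.conjExponent μ :=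
    memLp_indicator_const _ hA _ (Or.inr hA'.ne)
  set L := (ContinuousLinearMap.mul ℝ ℝ).lpPairing μ r.conjExponent r hW.toLp
  have hL : ∀ f : Lp ℝ r μ, L f = ∫ x in A, f x ∂μ := by
    intro f
    rw [ContinuousLinearMap.lpPairing_eq_integral, ← integral_indicator hA]
    refine integral_congr_ae ?_
    filter_upwards [hW.coeFn_toLp] with x hx
    rw [hx]
    by_cases hxA : x ∈ A <;> simp [hxA]
  simp_rw [← hL]
  exact (L.integral_comp_comm hG).symm

/-- A Bochner integral in `L^r` of functions with a jointly measurable version is almost everywhere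
given by the pointwise integral, which converges. -/
theorem ae_coeFn_integral_Lp [SFinite ν] [SigmaFinite μ] (hG : Integrable G ν)
    (hg : AEStronglyMeasurable (Function.uncurry g) (ν.prod μ)) (h : ∀ᵐ a ∂ν, G a =ᵐ[μ] g a) :
    ∀ᵐ x ∂μ, Integrable (fun a => g a x) ν ∧ (∫ a, G a ∂ν : Lp ℝ r μ) x = ∫ a, g a x ∂ν := by
  have hprod := fun {A : Set X} (hA : MeasurableSet A) (hA' : μ A < ∞) =>
    integrable_prod_restrict_of_integrable_Lp hG hg h hA hA'
  refine Filter.Eventually.and ?_ ?_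
  · have h1 : ∀ n, ∀ᵐ x ∂μ.restrict (spanningSets μ n), Integrable (fun a => g a x) ν := fun n =>
      (hprod (measurableSet_spanningSets μ n) (measure_spanningSets_lt_top μ n)).prod_left_ae
    have h2 := ae_restrict_iUnion_iff (μ := μ) (spanningSets μ) (fun x => Integrable (fun a => g a x) ν)
    rw [iUnion_spanningSets, Measure.restrict_univ] at h2
    exact h2.2 h1
  -- Both sides have the same integral over every set of finite measure: one by
  -- `setIntegral_integral_Lp`, the other by Fubini.
  · refine ae_eq_of_forall_setIntegral_eq_of_sigmaFinite ?_ ?_ ?_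
    · intro A hA hA'
      have : Fact (μ A < ∞) := ⟨hA'⟩
      exact ((Lp.memLp _).restrict A).integrable hr.out
    · intro A hA hA'
      exact (hprod hA hA').integral_prod_right
    · intro A hA hA'
      rw [setIntegral_integral_Lp hG hA hA', ← integral_integral_swap (hprod hA hA')]
      refine integral_congr_ae ?_
      filter_upwards [h] with a ha
      exact integral_congr_ae (ae_restrict_of_ae ha)

end Bochner

/-! ### Young's convolution inequality -/

/-- Write f g = (f^a g^b)^{1/r} (f^a)^{1 - 1/b} (g^b)^{1 - 1/a}. The outer exponents sum to 1 by
`h`, so three-factor Hölder applies in y. After raising to the power r, Tonelli evaluates the only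
factor that still depends on x. -/
theorem lintegral_rpow_convolution_le {d : ℕ} {a b r : ℝ} (ha : 1 ≤ a) (hb : 1 ≤ b) (hr : 1 ≤ r)
    (h : 1 / a + 1 / b = 1 + 1 / r) {f g : EuclideanSpace ℝ (Fin d) → ℝ≥0∞} (hf : Measurable f)
    (hg : Measurable g) :
    ∫⁻ x, (∫⁻ y, f (x - y) * g y) ^ r ≤
      (∫⁻ x, f x ^ a) ^ (r / a) * (∫⁻ x, g x ^ b) ^ (r / b) := by
  set F := ∫⁻ x, f x ^ a
  set H := ∫⁻ x, g x ^ b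
  have ha0 : 0 < a := by linarith
  have hb0 : 0 < b := by linarith
  have hr0 : 0 < r := by linarith
  have hra : 0 ≤ 1 / r := by positivity
  have h1a : 0 ≤ 1 - 1 / a := by
    rw [sub_nonneg, div_le_one ha0]; exact ha
  have h1b : 0 ≤ 1 - 1 / b := by
    rw [sub_nonneg, div_le_one hb0]; exact hb
  have hpt : ∀ x, (∫⁻ y, f (x - y) * g y) ^ r ≤
      (∫⁻ y, f (x - y) ^ a * g y ^ b) * (F ^ (r * (1 - 1 / b)) * H ^ (r * (1 - 1 / a))) := by
    intro x
    have hfx : Measurable fun y => f (x - y) := hf.comp (by fun_prop)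
    have h1 := ENNReal.lintegral_prod_norm_pow_le (μ := (volume : Measure (EuclideanSpace ℝ (Fin d))))
      (Finset.univ : Finset (Fin 3))
      (f := ![fun y => f (x - y) ^ a * g y ^ b, fun y => f (x - y) ^ a, fun y => g y ^ b])
      (p := ![1 / r, 1 - 1 / b, 1 - 1 / a])
      (by
        intro i _
        fin_cases i
        · exact ((hfx.pow_const a).mul (hg.pow_const b)).aemeasurable
        · exact (hfx.pow_const a).aemeasurable
        · exact (hg.pow_const b).aemeasurable)
      (by simp only [Fin.sum_univ_three, Matrix.cons_val]; linarith)
      (by intro i _; fin_cases i; exacts [hra, h1b, h1a])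
    simp only [Fin.prod_univ_three, Matrix.cons_val] at h1
    have h2 : ∀ y, (f (x - y) ^ a * g y ^ b) ^ (1 / r) * (f (x - y) ^ a) ^ (1 - 1 / b) *
        (g y ^ b) ^ (1 - 1 / a) = f (x - y) * g y := by
      intro y
      rw [ENNReal.mul_rpow_of_nonneg _ _ hra, ← ENNReal.rpow_mul, ← ENNReal.rpow_mul,
        ← ENNReal.rpow_mul, ← ENNReal.rpow_mul]
      have e1 : a * (1 / r) + a * (1 - 1 / b) = 1 := by
        have : a * (1 / r) + a * (1 - 1 / b) = a * (1 / a) := by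
          rw [← mul_add]; congr 1; linarith
        rw [this, mul_one_div_cancel ha0.ne']
      have e2 : b * (1 / r) + b * (1 - 1 / a) = 1 := by
        have : b * (1 / r) + b * (1 - 1 / a) = b * (1 / b) := by
          rw [← mul_add]; congr 1; linarith
        rw [this, mul_one_div_cancel hb0.ne']
      calc _ = (f (x - y) ^ (a * (1 / r)) * f (x - y) ^ (a * (1 - 1 / b))) *
            (g y ^ (b * (1 / r)) * g y ^ (b * (1 - 1 / a))) := by ring
        _ = _ := by
          rw [← ENNReal.rpow_add_of_nonneg _ _ (by positivity) (by positivity),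
            ← ENNReal.rpow_add_of_nonneg _ _ (by positivity) (by positivity), e1, e2,
            ENNReal.rpow_one, ENNReal.rpow_one]
    simp_rw [h2] at h1
    have hF : ∫⁻ y, f (x - y) ^ a = F := lintegral_sub_left_eq_self (fun y => f y ^ a) x
    rw [hF] at h1
    refine (ENNReal.rpow_le_rpow h1 hr0.le).trans (le_of_eq ?_)
    rw [ENNReal.mul_rpow_of_nonneg _ _ hr0.le, ENNReal.mul_rpow_of_nonneg _ _ hr0.le,
      ← ENNReal.rpow_mul, ← ENNReal.rpow_mul, ← ENNReal.rpow_mul, one_div_mul_cancel hr0.ne',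
      ENNReal.rpow_one, mul_comm (1 - 1 / b), mul_comm (1 - 1 / a), mul_assoc]
  have hmeas : Measurable (Function.uncurry fun x y : EuclideanSpace ℝ (Fin d) =>
      f (x - y) ^ a * g y ^ b) :=
    ((hf.comp (measurable_fst.sub measurable_snd)).pow_const a).mul
      ((hg.comp measurable_snd).pow_const b)
  have hZ : ∫⁻ x, ∫⁻ y, f (x - y) ^ a * g y ^ b = F * H := by
    rw [lintegral_lintegral_swap hmeas.aemeasurable]
    have : ∀ y, ∫⁻ x, f (x - y) ^ a * g y ^ b = F * g y ^ b := by
      intro y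
      have hfy : Measurable fun x => f (x - y) := hf.comp (by fun_prop)
      rw [lintegral_mul_const _ (hfy.pow_const a)]
      congr 1
      exact lintegral_sub_right_eq_self (fun y => f y ^ a) y
    simp_rw [this]
    rw [lintegral_const_mul _ (hg.pow_const b)]
  refine (lintegral_mono hpt).trans ?_
  rw [lintegral_mul_const _ hmeas.lintegral_prod_right, hZ]
  refine le_of_eq ?_
  have e1 : r / a = 1 + r * (1 - 1 / b) := by
    have : r * (1 / a + 1 / b) = r * (1 + 1 / r) := by rw [h]
    field_simp at this ⊢
    linarith
  have e2 : r / b = 1 + r * (1 - 1 / a) := by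
    have : r * (1 / a + 1 / b) = r * (1 + 1 / r) := by rw [h]
    field_simp at this ⊢
    linarith
  rw [e1, e2, ENNReal.rpow_add_of_nonneg _ _ zero_le_one (by positivity),
    ENNReal.rpow_add_of_nonneg _ _ zero_le_one (by positivity), ENNReal.rpow_one, ENNReal.rpow_one]
  ring

end

/-! ### Convolution operators on Lebesgue spaces and the norm of the kernel derivative -/

section

variable {d : ℕ}

theorem eLpNorm_rpow_eq_lintegral {X : Type*} [MeasurableSpace X] {μ : Measure X} {a : ℝ}
    (ha : 1 ≤ a) (f : X → ℝ) :
    eLpNorm f (ENNReal.ofReal a) μ ^ a = ∫⁻ x, ‖f x‖ₑ ^ a ∂μ := by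
  have ha0 : 0 < a := by linarith
  rw [eLpNorm_eq_lintegral_rpow_enorm_toReal (by simpa using ha0) ENNReal.ofReal_ne_top,
    ENNReal.toReal_ofReal ha0.le, ← ENNReal.rpow_mul, one_div_mul_cancel ha0.ne', ENNReal.rpow_one]

/-- **Young's convolution inequality** for the convolution integral of real functions. -/
theorem eLpNorm_convolution_le {a b r : ℝ} (ha : 1 ≤ a) (hb : 1 ≤ b) (hr : 1 ≤ r)
    (h : 1 / a + 1 / b = 1 + 1 / r) {k f : EuclideanSpace ℝ (Fin d) → ℝ} (hk : Measurable k)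
    (hf : Measurable f) :
    eLpNorm (fun x => ∫ y, k (x - y) * f y) (ENNReal.ofReal r) ≤
      eLpNorm k (ENNReal.ofReal a) * eLpNorm f (ENNReal.ofReal b) := by
  have ha0 : 0 < a := by linarith
  have hb0 : 0 < b := by linarith
  have hr0 : 0 < r := by linarith
  rw [← ENNReal.rpow_le_rpow_iff hr0, eLpNorm_rpow_eq_lintegral hr,
    ENNReal.mul_rpow_of_nonneg _ _ hr0.le]
  have h1 := lintegral_rpow_convolution_le ha hb hr h hk.enorm hf.enorm
  rw [← eLpNorm_rpow_eq_lintegral ha, ← eLpNorm_rpow_eq_lintegral hb, ← ENNReal.rpow_mul,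
    ← ENNReal.rpow_mul, mul_div_cancel₀ _ ha0.ne', mul_div_cancel₀ _ hb0.ne'] at h1
  refine le_trans (lintegral_mono fun x => ?_) h1
  refine ENNReal.rpow_le_rpow ((enorm_integral_le_lintegral_enorm _).trans (le_of_eq ?_)) hr0.le
  simp only [enorm_mul]

open Classical in
/-- The convolution `k * f` as an element of `L^r`, with value `0` if it is not in `L^r`. -/
def convLp (r : ℝ≥0∞) (k f : EuclideanSpace ℝ (Fin d) → ℝ) : LpV d r :=
  if h : MemLp (fun x => ∫ y, k (x - y) * f y) r then h.toLp _ else 0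

section

variable {a b r : ℝ} (ha : 1 ≤ a) (hb : 1 ≤ b) (hr : 1 ≤ r) (h : 1 / a + 1 / b = 1 + 1 / r)
include ha hb hr h

theorem memLp_convolution {k : EuclideanSpace ℝ (Fin d) → ℝ} (hk : Measurable k)
    (hkL : MemLp k (ENNReal.ofReal a)) (f : LpV d (ENNReal.ofReal b)) :
    MemLp (fun x => ∫ y, k (x - y) * f y) (ENNReal.ofReal r) := by
  have hf := (Lp.stronglyMeasurable f).measurable
  refine ⟨?_, (eLpNorm_convolution_le ha hb hr h hk hf).trans_lt
    (ENNReal.mul_lt_top hkL.2 (Lp.memLp f).2)⟩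
  refine (StronglyMeasurable.integral_prod_right (f := fun x y => k (x - y) * f y) ?_).aestronglyMeasurable
  exact ((hk.comp (measurable_fst.sub measurable_snd)).mul
    (hf.comp measurable_snd)).stronglyMeasurable

theorem coeFn_convLp {k : EuclideanSpace ℝ (Fin d) → ℝ} (hk : Measurable k)
    (hkL : MemLp k (ENNReal.ofReal a)) (f : LpV d (ENNReal.ofReal b)) :
    convLp (ENNReal.ofReal r) k f =ᵐ[volume] fun x => ∫ y, k (x - y) * f y := by
  rw [convLp, dif_pos (memLp_convolution ha hb hr h hk hkL f)]
  exact MemLp.coeFn_toLp _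

theorem norm_convLp_le {k : EuclideanSpace ℝ (Fin d) → ℝ} (hk : Measurable k)
    (hkL : MemLp k (ENNReal.ofReal a)) (f : LpV d (ENNReal.ofReal b)) :
    ‖convLp (ENNReal.ofReal r) k f‖ ≤ (eLpNorm k (ENNReal.ofReal a)).toReal * ‖f‖ := by
  rw [Lp.norm_def, Lp.norm_def, ← ENNReal.toReal_mul,
    eLpNorm_congr_ae (coeFn_convLp ha hb hr h hk hkL f)]
  exact ENNReal.toReal_mono (ENNReal.mul_lt_top hkL.2 (Lp.memLp f).2).ne
    (eLpNorm_convolution_le ha hb hr h hk (Lp.stronglyMeasurable f).measurable)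

variable {k : ℝ → EuclideanSpace ℝ (Fin d) → ℝ} (hk : IsKernelFamily k)
include hk

theorem IsKernelFamily.convLp_sub_right [Fact (1 ≤ ENNReal.ofReal b)] {t : ℝ} (ht : 0 < t)
    (f g : LpV d (ENNReal.ofReal b)) :
    convLp (ENNReal.ofReal r) (k t) (f - g : LpV d (ENNReal.ofReal b)) =
      convLp (ENNReal.ofReal r) (k t) f - convLp (ENNReal.ofReal r) (k t) g := by
  have hm := (hk.continuous ht).measurable
  have hL := hk.memLp ht (q := ENNReal.ofReal a) (by simpa using ha)
  refine Lp.ext ?_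
  filter_upwards [coeFn_convLp ha hb hr h hm hL f, coeFn_convLp ha hb hr h hm hL g,
    coeFn_convLp ha hb hr h hm hL (f - g), Lp.coeFn_sub (convLp (ENNReal.ofReal r) (k t) f)
      (convLp (ENNReal.ofReal r) (k t) g)] with x h1 h2 h3 h4
  rw [h4, Pi.sub_apply, h1, h2, h3, ← integral_sub (hk.integrable_mul ht x (Lp.memLp f))
    (hk.integrable_mul ht x (Lp.memLp g))]
  refine integral_congr_ae ?_
  filter_upwards [Lp.coeFn_sub f g] with y hy
  rw [hy, Pi.sub_apply, mul_sub]

theorem IsKernelFamily.convLp_sub_left [Fact (1 ≤ ENNReal.ofReal b)] {s t : ℝ} (hs : 0 < s)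
    (ht : 0 < t) (f : LpV d (ENNReal.ofReal b)) :
    convLp (ENNReal.ofReal r) (k s - k t) f =
      convLp (ENNReal.ofReal r) (k s) f - convLp (ENNReal.ofReal r) (k t) f := by
  have hms := (hk.continuous hs).measurable
  have hLs := hk.memLp hs (q := ENNReal.ofReal a) (by simpa using ha)
  have hmt := (hk.continuous ht).measurable
  have hLt := hk.memLp ht (q := ENNReal.ofReal a) (by simpa using ha)
  refine Lp.ext ?_
  filter_upwards [coeFn_convLp ha hb hr h hms hLs f, coeFn_convLp ha hb hr h hmt hLt f,
    coeFn_convLp ha hb hr h (hms.sub hmt) (hLs.sub hLt) f,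
    Lp.coeFn_sub (convLp (ENNReal.ofReal r) (k s) f)
      (convLp (ENNReal.ofReal r) (k t) f)] with x h1 h2 h3 h4
  rw [h4, Pi.sub_apply, h1, h2, h3, ← integral_sub (hk.integrable_mul hs x (Lp.memLp f))
    (hk.integrable_mul ht x (Lp.memLp f))]
  simp only [Pi.sub_apply, sub_mul]

omit hb hr h in
-- Dominated convergence: near `t` both kernels are below `C * decayWeight`, so their difference is
-- below twice that.
theorem IsKernelFamily.tendsto_eLpNorm_sub {t : ℝ} (ht : 0 < t) :
    Tendsto (fun s => (eLpNorm (k s - k t) (ENNReal.ofReal a)).toReal) (𝓝 t) (𝓝 0) := by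
  have ha0 : 0 < a := by linarith
  obtain ⟨C, hC0, hC⟩ := hk.decay t ht
  set W : EuclideanSpace ℝ (Fin d) → ℝ := fun y => 2 * C * decayWeight y with hW
  have hWL : MemLp W (ENNReal.ofReal a) := (memLp_decayWeight (by simpa using ha)).const_mul _
  have h1 : Tendsto (fun s => ∫⁻ x, ‖(k s - k t) x‖ₑ ^ a) (𝓝 t)
      (𝓝 (∫⁻ _ : EuclideanSpace ℝ (Fin d), 0)) := by
    refine tendsto_lintegral_filter_of_dominated_convergence (fun x => ‖W x‖ₑ ^ a) ?_ ?_ ?_ ?_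
    · filter_upwards [Ioi_mem_nhds ht] with s hs
      exact ((hk.continuous hs).sub (hk.continuous ht)).measurable.enorm.pow_const a
    · filter_upwards [hC] with s hs
      refine ae_of_all _ fun x => ENNReal.rpow_le_rpow ?_ ha0.le
      rw [enorm_le_iff_norm_le, Real.norm_of_nonneg (mul_nonneg (by positivity) (decayWeight_nonneg x))]
      have h2 := hC.self_of_nhds x
      have h3 := hs x
      have h4 := abs_sub (k s x) (k t x)
      rw [Pi.sub_apply, Real.norm_eq_abs]
      linarith
    · rw [← eLpNorm_rpow_eq_lintegral ha]
      exact (ENNReal.rpow_lt_top_of_nonneg ha0.le hWL.2.ne).ne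
    · refine ae_of_all _ fun x => ?_
      have h1 : ContinuousAt (fun z : ℝ × EuclideanSpace ℝ (Fin d) => k z.1 z.2) (t, x) :=
        hk.cont.continuousAt (prod_mem_nhds (Ioi_mem_nhds ht) univ_mem)
      have h2 : ContinuousAt (fun s => ‖(k s - k t) x‖ₑ ^ a) t := by
        refine (ENNReal.continuous_rpow_const.continuousAt).comp (continuous_enorm.continuousAt.comp ?_)
        exact ContinuousAt.sub (h1.comp (f := fun s => (s, x)) (by fun_prop)) continuousAt_const
      have h3 := h2.tendsto
      simpa [ha0] using h3
  have h2 := (ENNReal.continuous_rpow_const (y := 1 / a)).continuousAt.tendsto.comp h1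
  have h3 : ∀ s, (∫⁻ x, ‖(k s - k t) x‖ₑ ^ a) ^ (1 / a) =
      eLpNorm (k s - k t) (ENNReal.ofReal a) := by
    intro s
    rw [← eLpNorm_rpow_eq_lintegral ha, ← ENNReal.rpow_mul, mul_one_div_cancel ha0.ne',
      ENNReal.rpow_one]
  simp only [Function.comp_def, h3, lintegral_zero,
    ENNReal.zero_rpow_of_pos (show 0 < 1 / a by positivity)] at h2
  simpa [Function.comp_def] using (ENNReal.tendsto_toReal ENNReal.zero_ne_top).comp h2

theorem IsKernelFamily.continuousOn_convLp [Fact (1 ≤ ENNReal.ofReal b)]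
    [Fact (1 ≤ ENNReal.ofReal r)] :
    ContinuousOn (fun q : ℝ × LpV d (ENNReal.ofReal b) => convLp (ENNReal.ofReal r) (k q.1) q.2)
      (Set.Ioi 0 ×ˢ Set.univ) := by
  rintro ⟨t, f⟩ ⟨ht, -⟩
  replace ht : 0 < t := ht
  refine ContinuousAt.continuousWithinAt ?_
  have ha' : 1 ≤ ENNReal.ofReal a := by simpa using ha
  rw [ContinuousAt, tendsto_iff_norm_sub_tendsto_zero]
  have hlim : Tendsto (fun q : ℝ × LpV d (ENNReal.ofReal b) =>
      (eLpNorm (k q.1 - k t) (ENNReal.ofReal a)).toReal * ‖q.2‖ +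
        (eLpNorm (k t) (ENNReal.ofReal a)).toReal * ‖q.2 - f‖) (𝓝 (t, f)) (𝓝 (0 * ‖f‖ +
        (eLpNorm (k t) (ENNReal.ofReal a)).toReal * ‖f - f‖)) := by
    refine Tendsto.add (Tendsto.mul ?_ ?_) ?_
    · exact (hk.tendsto_eLpNorm_sub ha ht).comp
        (continuous_fst.tendsto (t, f))
    · exact (continuous_snd.norm).tendsto (t, f)
    · exact Continuous.tendsto (by fun_prop) (t, f)
  simp only [zero_mul, sub_self, norm_zero, mul_zero, add_zero] at hlim
  refine squeeze_zero' (Eventually.of_forall fun _ => norm_nonneg _) ?_ hlim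
  filter_upwards [(continuous_fst.tendsto (t, f)).eventually (Ioi_mem_nhds ht)] with q hq
  -- The kernel is varied first and the function second, so that each term is controlled by Young's
  -- inequality.
  have e : convLp (ENNReal.ofReal r) (k q.1) q.2 - convLp (ENNReal.ofReal r) (k t) f =
      convLp (ENNReal.ofReal r) (k q.1 - k t) q.2 +
        convLp (ENNReal.ofReal r) (k t) (q.2 - f : LpV d (ENNReal.ofReal b)) := by
    rw [hk.convLp_sub_left ha hb hr h hq ht, hk.convLp_sub_right ha hb hr h ht]
    abel
  rw [e]
  refine (norm_add_le _ _).trans (add_le_add ?_ ?_)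
  · exact norm_convLp_le ha hb hr h
      ((hk.continuous hq).sub (hk.continuous ht)).measurable
      ((hk.memLp hq ha').sub (hk.memLp ht ha')) _
  · exact norm_convLp_le ha hb hr h (hk.continuous ht).measurable (hk.memLp ht ha') _

end

theorem eLpNorm_decayWeight_comp_smul {a : ℝ} (ha : 1 ≤ a) {δ : ℝ} (hδ : 0 < δ) :
    (eLpNorm (fun z : EuclideanSpace ℝ (Fin d) => decayWeight (δ⁻¹ • z)) (ENNReal.ofReal a)).toReal =
      δ ^ ((d : ℝ) / a) * (eLpNorm (decayWeight (d := d)) (ENNReal.ofReal a)).toReal := by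
  have ha0 : 0 < a := by linarith
  have h1 := eLpNorm_map_measure (p := ENNReal.ofReal a) (μ := (volume : Measure (EuclideanSpace ℝ (Fin d))))
    (f := fun z : EuclideanSpace ℝ (Fin d) => δ⁻¹ • z) (g := decayWeight)
    (continuous_decayWeight.aestronglyMeasurable) (by fun_prop)
  rw [Measure.map_addHaar_smul _ (inv_ne_zero hδ.ne'), finrank_euclideanSpace_fin,
    eLpNorm_smul_measure_of_ne_top ENNReal.ofReal_ne_top] at h1
  have h2 : (fun z : EuclideanSpace ℝ (Fin d) => decayWeight (δ⁻¹ • z)) =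
      decayWeight ∘ fun z => δ⁻¹ • z := rfl
  rw [h2, ← h1, smul_eq_mul, ENNReal.toReal_mul, inv_pow, inv_inv, abs_of_pos (pow_pos hδ d),
    one_div, ENNReal.toReal_inv, ENNReal.toReal_ofReal ha0.le, ← ENNReal.toReal_rpow,
    ENNReal.toReal_ofReal (by positivity), ← Real.rpow_natCast, ← Real.rpow_mul hδ.le]
  rfl

/-- The `L^a` norm of the derivative of the L-KS kernel, uniformly for bounded times. -/
theorem exists_eLpNorm_kernelDerivDiff_le (l : Fin d) {a : ℝ} (ha : 1 ≤ a) (T : ℝ) :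
    ∃ C, 0 ≤ C ∧ ∀ t, 0 < t → t ≤ T →
      (eLpNorm (kernelDerivDiff d l t) (ENNReal.ofReal a)).toReal ≤
        C * scale t ^ ((d : ℝ) / a - (d + 1)) := by
  obtain ⟨C, hC0, hC⟩ := exists_decay_of_continuous_schwartz
    (continuous_profile_deriv d (EuclideanSpace.single l 1))
    (isCompact_Icc (a := (0 : ℝ)) (b := √T)) (d + 1)
  have ha' : 1 ≤ ENNReal.ofReal a := by simpa using ha
  refine ⟨C * (eLpNorm (decayWeight (d := d)) (ENNReal.ofReal a)).toReal, by positivity,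
    fun t ht htT => ?_⟩
  have hs := scale_pos ht
  have hpt : ∀ z, ‖kernelDerivDiff d l t z‖ ≤
      ((scale t ^ (d + 1))⁻¹ * C) * ‖decayWeight ((scale t)⁻¹ • z)‖ := by
    intro z
    rw [Real.norm_of_nonneg (decayWeight_nonneg _), kernelDerivDiff, norm_neg, norm_mul,
      Real.norm_of_nonneg (by positivity), mul_assoc]
    gcongr
    exact (Complex.abs_re_le_norm _).trans
      (hC √t ⟨Real.sqrt_nonneg _, Real.sqrt_le_sqrt htT⟩ _)
  have h1 := eLpNorm_le_mul_eLpNorm_of_ae_le_mul (ae_of_all (volume : Measure (EuclideanSpace ℝ (Fin d))) hpt) (ENNReal.ofReal a)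
  have hfin : eLpNorm (fun z : EuclideanSpace ℝ (Fin d) => decayWeight ((scale t)⁻¹ • z)) (ENNReal.ofReal a) ≠ ∞ := by
    refine (MemLp.mono ((memLp_decayWeight ha').const_mul ((1 + scale t) ^ (d + 1)))
      (continuous_decayWeight.comp (by fun_prop)).aestronglyMeasurable
      (ae_of_all _ fun z => ?_)).2.ne
    rw [Function.comp_apply, Real.norm_of_nonneg (decayWeight_nonneg _),
      Real.norm_of_nonneg (mul_nonneg (by positivity) (decayWeight_nonneg _))]
    exact decayWeight_inv_smul_le hs z
  have h2 := ENNReal.toReal_mono (ENNReal.mul_ne_top ENNReal.ofReal_ne_top hfin) h1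
  rw [ENNReal.toReal_mul, ENNReal.toReal_ofReal (by positivity),
    eLpNorm_decayWeight_comp_smul ha hs] at h2
  refine h2.trans (le_of_eq ?_)
  rw [Real.rpow_sub hs, div_eq_mul_inv]
  have : scale t ^ ((d : ℝ) + 1) = scale t ^ (d + 1) := by
    rw [← Real.rpow_natCast]; push_cast; rfl
  rw [this]
  ring

end

/-! ### The propagator on `L^r` and its strong continuity up to time zero -/

section

variable {d : ℕ} {r : ℝ≥0∞}

/-- Translation on `L^r(ℝ^d)`. -/
def translateLp (h : EuclideanSpace ℝ (Fin d)) (u : LpV d r) : LpV d r :=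
  Lp.compMeasurePreserving (fun x => x - h) (measurePreserving_sub_right volume h) u

theorem coeFn_translateLp (h : EuclideanSpace ℝ (Fin d)) (u : LpV d r) :
    translateLp h u =ᵐ[volume] fun x => u (x - h) :=
  Lp.coeFn_compMeasurePreserving u (measurePreserving_sub_right volume h)

theorem norm_translateLp (h : EuclideanSpace ℝ (Fin d)) (u : LpV d r) :
    ‖translateLp h u‖ = ‖u‖ :=
  Lp.norm_compMeasurePreserving u (measurePreserving_sub_right volume h)

theorem translateLp_sub (h : EuclideanSpace ℝ (Fin d)) (u v : LpV d r) :
    translateLp h (u - v) = translateLp h u - translateLp h v :=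
  map_sub (Lp.compMeasurePreserving (fun x => x - h) (measurePreserving_sub_right volume h)) u v

theorem translateLp_zero (u : LpV d r) : translateLp 0 u = u := by
  refine Lp.ext ?_
  filter_upwards [coeFn_translateLp 0 u] with x hx
  rw [hx, sub_zero]

/-- Translations are strongly continuous only for finite exponents. This is the source of the
condition `r ≠ ∞` on the propagator. -/
theorem continuous_translateLp [Fact (1 ≤ r)] (hr : r ≠ ∞) :
    Continuous fun q : EuclideanSpace ℝ (Fin d) × LpV d r => translateLp q.1 q.2 := by
  have hg : Continuous fun q : EuclideanSpace ℝ (Fin d) × LpV d r =>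
      (⟨fun x => x - q.1, by fun_prop⟩ : C(EuclideanSpace ℝ (Fin d), EuclideanSpace ℝ (Fin d))) :=
    ContinuousMap.continuous_of_continuous_uncurry _ (by
      simp only [Function.uncurry_def, ContinuousMap.coe_mk]; fun_prop)
  exact Continuous.compMeasurePreservingLp (μ := volume) (ν := volume) continuous_snd hg
    (fun q => measurePreserving_sub_right volume q.1) hr

/-- The propagator of `∂ₜ u = -(1/8) (Δ + 2)² u` on `L^r`, as a Bochner integral of translations. -/
def propagator [Fact (1 ≤ r)] (t : ℝ) (u : LpV d r) : LpV d r :=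
  ∫ w : EuclideanSpace ℝ (Fin d), (profile d √t w).re • translateLp (scale t • w) u

theorem exists_profile_bound (d : ℕ) (T : ℝ) : ∃ C, 0 ≤ C ∧ ∀ t ≤ T, ∀ w : EuclideanSpace ℝ (Fin d),
    |(profile d √t w).re| ≤ C * decayWeight w := by
  obtain ⟨C, hC0, hC⟩ := exists_decay_of_continuous_schwartz (continuous_profile d)
    (isCompact_Icc (a := (0 : ℝ)) (b := √T)) (d + 1)
  exact ⟨C, hC0, fun t ht w => (Complex.abs_re_le_norm _).trans
    (hC √t ⟨Real.sqrt_nonneg _, Real.sqrt_le_sqrt ht⟩ w)⟩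

theorem continuous_profile_re (d : ℕ) (t : ℝ) : Continuous fun w => (profile d √t w).re :=
  Complex.continuous_re.comp (profile d √t).continuous

section

variable [Fact (1 ≤ r)] (hr : r ≠ ∞)
include hr

theorem integrable_propagator (t : ℝ) (u : LpV d r) :
    Integrable fun w : EuclideanSpace ℝ (Fin d) =>
      (profile d √t w).re • translateLp (scale t • w) u := by
  obtain ⟨C, hC0, hC⟩ := exists_profile_bound d t
  have hcont : Continuous fun w : EuclideanSpace ℝ (Fin d) =>
      (profile d √t w).re • translateLp (scale t • w) u :=
    (continuous_profile_re d t).smul ((continuous_translateLp hr).comp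
      (f := fun w => (scale t • w, u)) (by fun_prop))
  refine (integrable_decayWeight.const_mul (C * ‖u‖)).mono hcont.aestronglyMeasurable
    (ae_of_all _ fun w => ?_)
  rw [norm_smul, norm_translateLp, Real.norm_of_nonneg
    (mul_nonneg (by positivity) (decayWeight_nonneg w)), mul_right_comm]
  exact mul_le_mul_of_nonneg_right (hC t le_rfl w) (norm_nonneg _)

theorem propagator_sub (t : ℝ) (u v : LpV d r) :
    propagator t (u - v) = propagator t u - propagator t v := by
  unfold propagator
  rw [← integral_sub (integrable_propagator hr t u) (integrable_propagator hr t v)]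
  simp_rw [translateLp_sub, smul_sub]

omit hr in
theorem exists_norm_propagator_le (d : ℕ) (T : ℝ) :
    ∃ C, 0 ≤ C ∧ ∀ t ≤ T, ∀ u : LpV d r, ‖propagator t u‖ ≤ C * ‖u‖ := by
  obtain ⟨C, hC0, hC⟩ := exists_profile_bound d T
  refine ⟨C * ∫ w : EuclideanSpace ℝ (Fin d), decayWeight w,
    mul_nonneg hC0 (integral_nonneg decayWeight_nonneg), fun t ht u => ?_⟩
  have h := norm_integral_le_of_norm_le (integrable_decayWeight.const_mul (C * ‖u‖))
    (f := fun w : EuclideanSpace ℝ (Fin d) => (profile d √t w).re • translateLp (scale t • w) u)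
    (ae_of_all _ fun w => by
      rw [norm_smul, norm_translateLp, mul_right_comm]
      exact mul_le_mul_of_nonneg_right (hC t ht w) (norm_nonneg _))
  refine h.trans (le_of_eq ?_)
  rw [integral_const_mul]
  ring

/-- The kernel degenerates to a point mass as t → 0, but in the variable w = z / `scale t` the
integrand stays continuous through t = 0 and is dominated by a multiple of `decayWeight`. This is
why the propagator is an average of translations rather than a convolution. -/
theorem continuous_propagator :
    Continuous fun q : ℝ × LpV d r => propagator q.1 q.2 := by
  rw [continuous_iff_continuousAt]
  rintro ⟨t₀, u₀⟩
  obtain ⟨C, hC0, hC⟩ := exists_profile_bound d (t₀ + 1)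
  refine continuousAt_of_dominated (F := fun (q : ℝ × LpV d r) (w : EuclideanSpace ℝ (Fin d)) =>
      (profile d √q.1 w).re • translateLp (scale q.1 • w) q.2) (bound := fun w => C * decayWeight w * (‖u₀‖ + 1)) ?_ ?_ ?_ ?_
  · exact Eventually.of_forall fun q => (integrable_propagator hr q.1 q.2).aestronglyMeasurable
  · filter_upwards [(continuous_fst.tendsto (t₀, u₀)).eventually (Iio_mem_nhds (lt_add_one t₀)),
      (continuous_snd.norm.tendsto (t₀, u₀)).eventually (Iio_mem_nhds (lt_add_one ‖u₀‖))]
      with q h1 h2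
    refine ae_of_all _ fun w => ?_
    rw [norm_smul, norm_translateLp]
    exact mul_le_mul (hC _ (le_of_lt h1) w) (le_of_lt h2) (norm_nonneg _)
      (mul_nonneg hC0 (decayWeight_nonneg w))
  · exact (integrable_decayWeight.const_mul C).mul_const _
  · refine ae_of_all _ fun w => Continuous.continuousAt ?_
    have h1 : Continuous fun q : ℝ × LpV d r => (profile d √q.1 w).re :=
      Complex.continuous_re.comp ((continuous_uncurry_of_continuous_schwartz
        (continuous_profile d)).comp (f := fun q : ℝ × LpV d r => (√q.1, w)) (by fun_prop))
    have h2 : Continuous fun q : ℝ × LpV d r => scale q.1 • w :=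
      (continuous_scale.comp continuous_fst).smul continuous_const
    exact h1.smul ((continuous_translateLp hr).comp (h2.prodMk continuous_snd))

omit hr in
theorem propagator_zero (u : LpV d r) : propagator 0 u = u := by
  have h0 : scale 0 = 0 := by simp [scale]
  have h1 : ∫ w, (profile d 0 w).re = 1 := by
    have := integral_re (profile d 0).integrable (μ := volume)
    simp only [RCLike.re_to_complex] at this
    rw [this, integral_profile_zero, Complex.one_re]
  simp [propagator, h0, translateLp_zero, integral_smul_const, h1]

/-- For positive times the substitution z = `scale t` w recovers the convolution with the L-KS
kernel; its Jacobian cancels the normalization in `kernelDiff`. -/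
theorem coeFn_propagator {t : ℝ} (ht : 0 < t) (u : LpV d r) :
    propagator t u =ᵐ[volume] fun x => ∫ y, kernelDiff d t (x - y) * u y := by
  have hs := scale_pos ht
  have hum := (Lp.stronglyMeasurable u).measurable
  have h := ae_coeFn_integral_Lp (g := fun w x => (profile d √t w).re * u (x - scale t • w))
    (integrable_propagator hr t u) (by
      refine (Measurable.mul ?_ ?_).aestronglyMeasurable
      · exact (continuous_profile_re d t).measurable.comp measurable_fst
      · exact hum.comp (by fun_prop))
    (ae_of_all _ fun w => by
      filter_upwards [Lp.coeFn_smul (profile d √t w).re (translateLp (scale t • w) u),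
        coeFn_translateLp (scale t • w) u] with x h1 h2
      rw [h1, Pi.smul_apply, h2, smul_eq_mul])
  filter_upwards [h] with x hx
  rw [propagator, hx.2]
  have h1 := integral_sub_left_eq_self (fun z => kernelDiff d t z * u (x - z)) volume x
  simp only [sub_sub_cancel] at h1
  have h2 := Measure.integral_comp_smul (volume : Measure (EuclideanSpace ℝ (Fin d)))
    (fun z => kernelDiff d t z * u (x - z)) (scale t)
  rw [finrank_euclideanSpace_fin, smul_eq_mul, abs_of_pos (by positivity)] at h2
  rw [h1, ← mul_inv_cancel_left₀ (pow_pos hs d).ne' (∫ z, kernelDiff d t z * u (x - z)), ← h2,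
    ← integral_const_mul]
  refine integral_congr_ae (ae_of_all _ fun w => ?_)
  simp only [kernelDiff, inv_smul_smul₀ hs.ne']
  have := (pow_pos hs d).ne'
  field_simp

end

end

section

/-! ### Volterra equations with a singular locally Lipschitz kernel -/

section Volterra

variable {E : Type*} [NormedAddCommGroup E] [NormedSpace ℝ E]

/-- A kernel `Ψ` on `(0, T]`, locally Lipschitz in the second variable with linear growth of the
Lipschitz constant and an integrable weight in time. -/
structure IsSingularKernel (T : ℝ) (w : ℝ → ℝ) (Ψ : ℝ → E → E) : Prop where
  map_zero : ∀ t, 0 < t → Ψ t 0 = 0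
  lip : ∀ t, 0 < t → t ≤ T → ∀ u v, ‖Ψ t u - Ψ t v‖ ≤ w t * ((1 + ‖u‖ + ‖v‖) * ‖u - v‖)
  cont : ContinuousOn (fun q : ℝ × E => Ψ q.1 q.2) (Set.Ioi 0 ×ˢ Set.univ)
  weight_nonneg : ∀ t, 0 ≤ w t
  weight_int : IntegrableOn w (Set.Ioc 0 T)

namespace IsSingularKernel

variable {T : ℝ} {w : ℝ → ℝ} {Ψ : ℝ → E → E} (hΨ : IsSingularKernel T w Ψ)
include hΨ

omit [NormedSpace ℝ E] in
theorem norm_le {t : ℝ} (ht : 0 < t) (htT : t ≤ T) (u : E) :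
    ‖Ψ t u‖ ≤ w t * ((1 + ‖u‖) * ‖u‖) := by
  simpa [hΨ.map_zero t ht] using hΨ.lip t ht htT u 0

omit [NormedSpace ℝ E] in
theorem integrableOn_comp_sub {U : ℝ → E} {t : ℝ} (ht : t ≤ T)
    (hU : ContinuousOn U (Set.Icc 0 t)) :
    IntegrableOn (fun s => Ψ s (U (t - s))) (Set.Ioc 0 t) := by
  obtain ⟨M, hM⟩ := isCompact_Icc.exists_bound_of_continuousOn hU
  have hmem : ∀ s ∈ Set.Ioc 0 t, t - s ∈ Set.Icc 0 t := fun s hs =>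
    ⟨by linarith [hs.2], by linarith [hs.1]⟩
  have hw : IntegrableOn (fun s => w s * ((1 + M) * M)) (Set.Ioc 0 t) :=
    (hΨ.weight_int.mono_set (Set.Ioc_subset_Ioc_right ht)).mul_const _
  refine hw.mono' ?_ ?_
  · refine ContinuousOn.aestronglyMeasurable ?_ measurableSet_Ioc
    exact hΨ.cont.comp (f := fun s => (s, U (t - s)))
      (continuousOn_id.prodMk (hU.comp (by fun_prop) hmem)) fun s hs => ⟨hs.1, trivial⟩
  · refine (ae_restrict_iff' measurableSet_Ioc).2 (ae_of_all _ fun s hs => ?_)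
    have h1 := hM _ (hmem s hs)
    refine (hΨ.norm_le hs.1 (hs.2.trans ht) _).trans ?_
    have := hΨ.weight_nonneg s
    have := norm_nonneg (U (t - s))
    have hM0 : 0 ≤ M := by linarith
    gcongr

omit [NormedSpace ℝ E] in
theorem intervalIntegrable_sub {U : ℝ → E} {t : ℝ} (ht0 : 0 ≤ t) (ht : t ≤ T)
    (hU : ContinuousOn U (Set.Icc 0 t)) :
    IntervalIntegrable (fun s => Ψ (t - s) (U s)) volume 0 t := by
  have h := (intervalIntegrable_iff_integrableOn_Ioc_of_le ht0).2 (hΨ.integrableOn_comp_sub ht hU)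
  simpa using (h.comp_sub_left t).symm

omit [NormedSpace ℝ E] in
-- In the norm sup e^{-nt}‖·‖ the Lipschitz constant of the Volterra operator on a bounded set is a
-- multiple of this integral. For large n it is below 1 on all of [0, T], so uniqueness needs no
-- step-by-step continuation.
theorem tendsto_integral_weight_mul_exp :
    Tendsto (fun n : ℕ => ∫ s in Set.Ioc 0 T, w s * Real.exp (-(n * s))) atTop (𝓝 0) := by
  have h := tendsto_integral_of_dominated_convergence (μ := volume.restrict (Set.Ioc 0 T))
    (F := fun (n : ℕ) s => w s * Real.exp (-(n * s))) (f := fun _ => 0) w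
    (fun n => hΨ.weight_int.aestronglyMeasurable.mul (by fun_prop)) hΨ.weight_int
    (fun n => (ae_restrict_iff' measurableSet_Ioc).2 (ae_of_all _ fun s hs => by
      rw [norm_mul, Real.norm_of_nonneg (hΨ.weight_nonneg s), Real.norm_of_nonneg (Real.exp_nonneg _)]
      refine mul_le_of_le_one_right (hΨ.weight_nonneg s) (Real.exp_le_one_iff.2 ?_)
      have := hs.1.le
      have : 0 ≤ (n : ℝ) * s := by positivity
      linarith))
    ((ae_restrict_iff' measurableSet_Ioc).2 (ae_of_all _ fun s hs => by
      have h1 : Tendsto (fun n : ℕ => (n : ℝ) * s) atTop atTop :=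
        tendsto_natCast_atTop_atTop.atTop_mul_const hs.1
      simpa using (Real.tendsto_exp_neg_atTop_nhds_zero.comp h1).const_mul (w s)))
  simpa using h

/-- Uniqueness for the Volterra equation `U t = L t + ∫₀ᵗ Ψ (t - s) (U s) ds`. -/
theorem eqOn_of_volterra {L U V : ℝ → E} (hU : ContinuousOn U (Set.Icc 0 T))
    (hV : ContinuousOn V (Set.Icc 0 T))
    (hUe : ∀ t ∈ Set.Icc 0 T, U t = L t + ∫ s in (0 : ℝ)..t, Ψ (t - s) (U s))
    (hVe : ∀ t ∈ Set.Icc 0 T, V t = L t + ∫ s in (0 : ℝ)..t, Ψ (t - s) (V s)) :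
    Set.EqOn U V (Set.Icc 0 T) := by
  rcases lt_or_ge T 0 with hT | hT
  · simp [Set.Icc_eq_empty (not_le.2 hT)]
  obtain ⟨M₁, hM₁⟩ := isCompact_Icc.exists_bound_of_continuousOn hU
  obtain ⟨M₂, hM₂⟩ := isCompact_Icc.exists_bound_of_continuousOn hV
  have h0T : (0 : ℝ) ∈ Set.Icc 0 T := ⟨le_rfl, hT⟩
  set A := 1 + M₁ + M₂ with hA
  have hA0 : 0 < A := by
    have := (norm_nonneg _).trans (hM₁ 0 h0T)
    have := (norm_nonneg _).trans (hM₂ 0 h0T)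
    positivity
  obtain ⟨n, hn⟩ := ((hΨ.tendsto_integral_weight_mul_exp.const_mul A).eventually
    (gt_mem_nhds (show A * 0 < 1 by simp))).exists
  set θ := A * ∫ s in Set.Ioc 0 T, w s * Real.exp (-(n * s))
  have hcont : ContinuousOn (fun t => Real.exp (-(n * t)) * ‖U t - V t‖) (Set.Icc 0 T) :=
    (by fun_prop : Continuous fun t : ℝ => Real.exp (-(n * t))).continuousOn.mul (hU.sub hV).norm
  -- At a maximizer of the weighted difference the equation yields m ≤ mθ with θ < 1, forcing m = 0.
  obtain ⟨t, ht, hmax⟩ := isCompact_Icc.exists_isMaxOn ⟨0, h0T⟩ hcont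
  set m := Real.exp (-(n * t)) * ‖U t - V t‖ with hm
  have hm0 : 0 ≤ m := by positivity
  have hD : ∀ s ∈ Set.Icc 0 T, ‖U s - V s‖ ≤ Real.exp (n * s) * m := by
    intro s hs
    have h1 : Real.exp (-(n * s)) * ‖U s - V s‖ ≤ m := hmax hs
    calc ‖U s - V s‖ = Real.exp (n * s) * (Real.exp (-(n * s)) * ‖U s - V s‖) := by
          rw [← mul_assoc, ← Real.exp_add]; simp
      _ ≤ _ := by gcongr
  have hsub : Set.Icc 0 t ⊆ Set.Icc 0 T := Set.Icc_subset_Icc_right ht.2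
  have hw : IntegrableOn (fun s => w s * Real.exp (-(n * s))) (Set.Ioc 0 T) := by
    refine hΨ.weight_int.mul_bdd (c := 1) (by fun_prop) ?_
    refine (ae_restrict_iff' measurableSet_Ioc).2 (ae_of_all _ fun s hs => ?_)
    rw [Real.norm_of_nonneg (Real.exp_nonneg _), Real.exp_le_one_iff]
    have := hs.1.le
    have : 0 ≤ (n : ℝ) * s := by positivity
    linarith
  have hdiff : U t - V t = ∫ s in (0 : ℝ)..t, (Ψ s (U (t - s)) - Ψ s (V (t - s))) := by
    have h1 := intervalIntegral.integral_comp_sub_left (a := 0) (b := t)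
      (fun s => Ψ s (U (t - s)) - Ψ s (V (t - s))) t
    simp only [sub_sub_cancel, sub_self, sub_zero] at h1
    rw [← h1, hUe t ht, hVe t ht, intervalIntegral.integral_sub
      (hΨ.intervalIntegrable_sub ht.1 ht.2 (hU.mono hsub))
      (hΨ.intervalIntegrable_sub ht.1 ht.2 (hV.mono hsub))]
    abel
  have hwt : IntervalIntegrable (fun s => w s * Real.exp (-(n * s)) * (A * (Real.exp (n * t) * m)))
      volume 0 t :=
    ((intervalIntegrable_iff_integrableOn_Ioc_of_le ht.1).2
      (hw.mono_set (Set.Ioc_subset_Ioc_right ht.2))).mul_const _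
  have hest : ‖U t - V t‖ ≤ Real.exp (n * t) * (m * θ) := by
    rw [hdiff]
    refine (intervalIntegral.norm_integral_le_of_norm_le ht.1 (ae_of_all _ fun s hs => ?_) hwt).trans ?_
    · have hts : t - s ∈ Set.Icc 0 T := ⟨by linarith [hs.2], by linarith [hs.1, ht.2]⟩
      refine (hΨ.lip s hs.1 (hs.2.trans ht.2) _ _).trans ?_
      have h1 := hM₁ _ hts
      have h2 := hM₂ _ hts
      have h3 := hD _ hts
      have h4 : Real.exp (n * (t - s)) = Real.exp (-(n * s)) * Real.exp (n * t) := by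
        rw [← Real.exp_add]; ring_nf
      rw [h4] at h3
      have h5 := hΨ.weight_nonneg s
      calc w s * ((1 + ‖U (t - s)‖ + ‖V (t - s)‖) * ‖U (t - s) - V (t - s)‖)
          ≤ w s * ((1 + M₁ + M₂) * (Real.exp (-(n * s)) * Real.exp (n * t) * m)) := by gcongr
        _ = _ := by rw [hA]; ring
    · rw [intervalIntegral.integral_mul_const, intervalIntegral.integral_of_le ht.1]
      have h1 : ∫ s in Set.Ioc 0 t, w s * Real.exp (-(n * s)) ≤
          ∫ s in Set.Ioc 0 T, w s * Real.exp (-(n * s)) :=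
        setIntegral_mono_set hw (ae_of_all _ fun s =>
          mul_nonneg (hΨ.weight_nonneg s) (Real.exp_nonneg _))
          (Set.Ioc_subset_Ioc_right ht.2).eventuallyLE
      calc _ ≤ (∫ s in Set.Ioc 0 T, w s * Real.exp (-(n * s))) * (A * (Real.exp (n * t) * m)) := by
            gcongr
        _ = _ := by ring
  have hmθ : m ≤ m * θ := by
    calc m ≤ Real.exp (-(n * t)) * (Real.exp (n * t) * (m * θ)) := by rw [hm]; gcongr
      _ = m * θ := by rw [← mul_assoc, ← Real.exp_add]; simp
  have hm00 : m = 0 := by nlinarith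
  intro s hs
  have := hD s hs
  rw [hm00, mul_zero] at this
  exact sub_eq_zero.1 (norm_le_zero_iff.1 this)

/-- The indicator keeps the domain of integration independent of `t`, so dominated convergence
applies. Its jump affects only s = t₀, a null set. -/
theorem continuous_integral_comp_sub {U : ℝ → E} (hU : Continuous U) {M τ : ℝ}
    (hM : ∀ s, ‖U s‖ ≤ M) (hτ : τ ≤ T) :
    Continuous fun t => ∫ s in Set.Ioc 0 τ, (Set.Iio t).indicator (fun s => Ψ s (U (t - s))) s := by
  rw [continuous_iff_continuousAt]
  intro t₀
  refine continuousAt_of_dominated (bound := fun s => w s * ((1 + M) * M)) ?_ ?_ ?_ ?_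
  · refine Eventually.of_forall fun t => AEStronglyMeasurable.indicator ?_ measurableSet_Iio
    refine ContinuousOn.aestronglyMeasurable ?_ measurableSet_Ioc
    exact hΨ.cont.comp (f := fun s => (s, U (t - s))) (by fun_prop) fun s hs => ⟨hs.1, trivial⟩
  · refine Eventually.of_forall fun t =>
      (ae_restrict_iff' measurableSet_Ioc).2 (ae_of_all _ fun s hs => ?_)
    refine (norm_indicator_le_norm_self _ _).trans ((hΨ.norm_le hs.1 (hs.2.trans hτ) _).trans ?_)
    have := hΨ.weight_nonneg s
    have := hM (t - s)
    have := norm_nonneg (U (t - s))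
    have hM0 : 0 ≤ M := by linarith
    gcongr
  · exact (hΨ.weight_int.mono_set (Set.Ioc_subset_Ioc_right hτ)).mul_const _
  · have hne : ∀ᵐ s ∂(volume : Measure ℝ), s ≠ t₀ := by simp [ae_iff]
    refine (ae_restrict_iff' measurableSet_Ioc).2 ?_
    filter_upwards [hne] with s hst hs
    rcases lt_or_gt_of_ne hst with h | h
    · have h1 : ContinuousAt (fun t => Ψ s (U (t - s))) t₀ := by
        have h2 : ContinuousAt (fun q : ℝ × E => Ψ q.1 q.2) (s, U (t₀ - s)) :=
          hΨ.cont.continuousAt (prod_mem_nhds (Ioi_mem_nhds hs.1) univ_mem)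
        exact h2.comp (f := fun t => (s, U (t - s))) (by fun_prop)
      refine h1.congr ?_
      filter_upwards [Ioi_mem_nhds h] with t ht
      rw [Set.indicator_of_mem (Set.mem_Iio.2 ht)]
    · refine (continuousAt_const (y := (0 : E))).congr ?_
      filter_upwards [Iio_mem_nhds h] with t ht
      rw [Set.indicator_of_notMem (by simpa using (Set.mem_Iio.1 ht).le)]

omit hΨ in
theorem setIntegral_indicator_Iio_eq (f : ℝ → E) {t τ : ℝ} (ht : 0 ≤ t) (htτ : t ≤ τ) :
    ∫ s in Set.Ioc 0 τ, (Set.Iio t).indicator f s = ∫ s in (0 : ℝ)..t, f s := by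
  rw [setIntegral_indicator measurableSet_Iio, intervalIntegral.integral_of_le ht,
    integral_Ioc_eq_integral_Ioo]
  congr 2
  ext s
  simp only [Set.mem_inter_iff, Set.mem_Ioc, Set.mem_Iio, Set.mem_Ioo]
  constructor
  · rintro ⟨⟨h1, -⟩, h2⟩; exact ⟨h1, h2⟩
  · rintro ⟨h1, h2⟩; exact ⟨⟨h1, h2.le.trans htτ⟩, h2⟩

/-- Local existence for the Volterra equation `U t = L t + ∫₀ᵗ Ψ (t - s) (U s) ds`. -/
theorem exists_volterra [CompleteSpace E] (hT : 0 < T) {L : ℝ → E} (hL : Continuous L) :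
    ∃ τ, 0 < τ ∧ τ ≤ T ∧ ∃ U : ℝ → E, Continuous U ∧
      ∀ t ∈ Set.Icc 0 τ, U t = L t + ∫ s in (0 : ℝ)..t, Ψ (t - s) (U s) := by
  obtain ⟨M, hM⟩ := (isCompact_Icc (a := (0 : ℝ)) (b := T)).exists_bound_of_continuousOn
    hL.continuousOn
  have hM0 : 0 ≤ M := (norm_nonneg _).trans (hM 0 ⟨le_rfl, hT.le⟩)
  -- `M` bounds the free term; the additional 1 leaves room for the integral term.
  set R := M + 1 with hR
  have hW : ContinuousOn (fun τ => ∫ s in Set.Ioc 0 τ, w s) (Set.Icc 0 T) :=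
    intervalIntegral.continuousOn_primitive ((integrableOn_Icc_iff_integrableOn_Ioc (by simp)).2 hΨ.weight_int)
  -- One smallness condition serves twice: the product dominates (1 + R)R, needed to preserve the
  -- ball, and 1 + 2R, the Lipschitz factor on it.
  obtain ⟨τ, hτ0, hτT, hτ⟩ : ∃ τ, 0 < τ ∧ τ ≤ T ∧
      (∫ s in Set.Ioc 0 τ, w s) * ((1 + R + R) * (1 + R)) < 1 / 2 := by
    have h1 : Tendsto (fun τ => (∫ s in Set.Ioc 0 τ, w s) * ((1 + R + R) * (1 + R))) (𝓝[>] 0)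
        (𝓝 0) := by
      have h0 : ContinuousWithinAt (fun τ => ∫ s in Set.Ioc 0 τ, w s) (Set.Ioi 0) 0 :=
        (hW 0 ⟨le_rfl, hT.le⟩).mono_of_mem_nhdsWithin
          (mem_of_superset (Ioc_mem_nhdsGT hT) Set.Ioc_subset_Icc_self)
      have := h0.tendsto.mul_const ((1 + R + R) * (1 + R))
      simpa using this
    obtain ⟨τ, h2, h3⟩ := ((h1.eventually (gt_mem_nhds (show (0 : ℝ) < 1 / 2 by norm_num))).and
      (Ioc_mem_nhdsGT hT)).exists
    exact ⟨τ, h3.1, h3.2, h2⟩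
  set W := ∫ s in Set.Ioc 0 τ, w s with hWdef
  have hW0 : 0 ≤ W := integral_nonneg hΨ.weight_nonneg
  have hwτ := hΨ.weight_int.mono_set (Set.Ioc_subset_Ioc_right hτT)
  -- Extension by the endpoint values is continuous and bounded on the whole line, as
  -- `continuous_integral_comp_sub` requires.
  let ext : C(Set.Icc 0 τ, E) → ℝ → E := fun u => Set.IccExtend hτ0.le u
  have hext : ∀ u, Continuous (ext u) := fun u => u.continuous.Icc_extend'
  have hextn : ∀ u s, ‖ext u s‖ ≤ ‖u‖ := fun u s => u.norm_coe_le_norm _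
  have hextd : ∀ u v s, ‖ext u s - ext v s‖ ≤ ‖u - v‖ := fun u v s =>
    (u - v).norm_coe_le_norm _
  let F : C(Set.Icc 0 τ, E) → C(Set.Icc 0 τ, E) := fun u =>
    ⟨fun t => L t + ∫ s in Set.Ioc 0 τ, (Set.Iio (t : ℝ)).indicator
        (fun s => Ψ s (ext u (t - s))) s,
      (hL.comp continuous_subtype_val).add
        ((hΨ.continuous_integral_comp_sub (hext u) (hextn u) hτT).comp continuous_subtype_val)⟩
  have hF : ∀ u (t : Set.Icc 0 τ), F u t = L t + ∫ s in (0 : ℝ)..t, Ψ s (ext u (t - s)) := by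
    intro u t
    simp only [F, ContinuousMap.coe_mk]
    rw [setIntegral_indicator_Iio_eq _ t.2.1 t.2.2]
  have hint : ∀ u (t : Set.Icc 0 τ),
      IntervalIntegrable (fun s => Ψ s (ext u (t - s))) volume 0 t := fun u t =>
    (intervalIntegrable_iff_integrableOn_Ioc_of_le t.2.1).2
      (hΨ.integrableOn_comp_sub (t.2.2.trans hτT) (hext u).continuousOn)
  have hbound : ∀ (t : Set.Icc 0 τ) (c : ℝ) (f : ℝ → E), 0 ≤ c →
      (∀ s ∈ Set.Ioc 0 (t : ℝ), ‖f s‖ ≤ w s * c) → ‖∫ s in (0 : ℝ)..t, f s‖ ≤ W * c := by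
    intro t c f hc hf
    have h1 := hwτ.mono_set (Set.Ioc_subset_Ioc_right t.2.2)
    refine (intervalIntegral.norm_integral_le_of_norm_le t.2.1 (ae_of_all _ hf)
      (((intervalIntegrable_iff_integrableOn_Ioc_of_le t.2.1).2 h1).mul_const c)).trans ?_
    rw [intervalIntegral.integral_mul_const, intervalIntegral.integral_of_le t.2.1]
    refine mul_le_mul_of_nonneg_right ?_ hc
    exact setIntegral_mono_set hwτ (ae_of_all _ hΨ.weight_nonneg)
      (Set.Ioc_subset_Ioc_right t.2.2).eventuallyLE
  set B : Set C(Set.Icc 0 τ, E) := Metric.closedBall 0 R with hB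
  have hmaps : Set.MapsTo F B B := by
    intro u hu
    rw [hB, mem_closedBall_zero_iff] at hu ⊢
    refine (ContinuousMap.norm_le _ (by positivity)).2 fun t => ?_
    rw [hF]
    refine (norm_add_le _ _).trans (add_le_add (hM t ⟨t.2.1, t.2.2.trans hτT⟩) ?_)
    refine (hbound t ((1 + R) * R) _ (by positivity) fun s hs => ?_).trans ?_
    · refine (hΨ.norm_le hs.1 (hs.2.trans (t.2.2.trans hτT)) _).trans ?_
      have h1 := (hextn u (t - s)).trans hu
      have := hΨ.weight_nonneg s
      gcongr
    · have h1 : W * ((1 + R) * R) ≤ W * ((1 + R + R) * (1 + R)) := by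
        gcongr ?_ * ?_
        nlinarith
      linarith
  have hcontr : ContractingWith (1 / 2) (hmaps.restrict F B B) := by
    refine ⟨by norm_num, LipschitzWith.of_dist_le_mul fun u v => ?_⟩
    have hu := mem_closedBall_zero_iff.1 u.2
    have hv := mem_closedBall_zero_iff.1 v.2
    rw [Subtype.dist_eq, Subtype.dist_eq, dist_eq_norm, dist_eq_norm]
    simp only [Set.MapsTo.val_restrict_apply]
    refine (ContinuousMap.norm_le _ (by positivity)).2 fun t => ?_
    rw [ContinuousMap.sub_apply, hF, hF, add_sub_add_left_eq_sub,
      ← intervalIntegral.integral_sub (hint _ t) (hint _ t)]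
    refine (hbound t ((1 + R + R) * ‖(u : C(Set.Icc 0 τ, E)) - v‖) _ (by positivity)
      fun s hs => ?_).trans ?_
    · refine (hΨ.lip s hs.1 (hs.2.trans (t.2.2.trans hτT)) _ _).trans ?_
      have h1 := (hextn u (t - s)).trans hu
      have h2 := (hextn v (t - s)).trans hv
      have h3 := hextd u v (t - s)
      have := hΨ.weight_nonneg s
      gcongr
    · rw [← mul_assoc]
      refine mul_le_mul_of_nonneg_right ?_ (norm_nonneg _)
      have h1 : W * (1 + R + R) ≤ W * ((1 + R + R) * (1 + R)) := by
        gcongr ?_ * ?_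
        nlinarith
      have : ((1 / 2 : NNReal) : ℝ) = 1 / 2 := by norm_num
      rw [this]
      linarith
  obtain ⟨u, -, hu, -, -⟩ := hcontr.exists_fixedPoint' (x := 0)
    (Metric.isClosed_closedBall.isComplete) hmaps (by simp [hB]; positivity) (edist_ne_top _ _)
  refine ⟨τ, hτ0, hτT, ext u, hext u, fun t ht => ?_⟩
  have h1 : ext u t = u ⟨t, ht⟩ := Set.IccExtend_of_mem hτ0.le u ht
  have h2 : u ⟨t, ht⟩ = F u ⟨t, ht⟩ := by rw [hu]
  rw [h1, h2, hF]
  have h3 := intervalIntegral.integral_comp_sub_left (a := 0) (b := t)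
      (fun s => Ψ s (ext u (t - s))) t
  simp only [sub_sub_cancel, sub_self, sub_zero] at h3
  rw [← h3]

end IsSingularKernel

end Volterra

end

section

/-! ### The singular kernel of the Kuramoto–Sivashinsky–Burgers equation -/

namespace IsSingularKernel

variable {E : Type*} [NormedAddCommGroup E] {T : ℝ}

theorem add {w₁ w₂ : ℝ → ℝ} {Ψ₁ Ψ₂ : ℝ → E → E} (h₁ : IsSingularKernel T w₁ Ψ₁)
    (h₂ : IsSingularKernel T w₂ Ψ₂) :
    IsSingularKernel T (fun t => w₁ t + w₂ t) (fun t u => Ψ₁ t u + Ψ₂ t u) where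
  map_zero t ht := by rw [h₁.map_zero t ht, h₂.map_zero t ht, add_zero]
  lip t ht htT u v := by
    rw [add_sub_add_comm, add_mul]
    exact (norm_add_le _ _).trans (add_le_add (h₁.lip t ht htT u v) (h₂.lip t ht htT u v))
  cont := h₁.cont.add h₂.cont
  weight_nonneg t := add_nonneg (h₁.weight_nonneg t) (h₂.weight_nonneg t)
  weight_int := h₁.weight_int.add h₂.weight_int

theorem const_smul [NormedSpace ℝ E] {w : ℝ → ℝ} {Ψ : ℝ → E → E} (h : IsSingularKernel T w Ψ)
    {c : ℝ} (hc : 0 ≤ c) :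
    IsSingularKernel T (fun t => c * w t) (fun t u => c • Ψ t u) where
  map_zero t ht := by rw [h.map_zero t ht, smul_zero]
  lip t ht htT u v := by
    rw [← smul_sub, norm_smul, Real.norm_of_nonneg hc, mul_assoc]
    exact mul_le_mul_of_nonneg_left (h.lip t ht htT u v) hc
  cont := h.cont.const_smul c
  weight_nonneg t := mul_nonneg hc (h.weight_nonneg t)
  weight_int := h.weight_int.const_mul c

theorem sum {ι : Type*} (s : Finset ι) {w : ι → ℝ → ℝ} {Ψ : ι → ℝ → E → E}
    (h : ∀ i ∈ s, IsSingularKernel T (w i) (Ψ i)) :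
    IsSingularKernel T (fun t => ∑ i ∈ s, w i t) (fun t u => ∑ i ∈ s, Ψ i t u) where
  map_zero t ht := Finset.sum_eq_zero fun i hi => (h i hi).map_zero t ht
  lip t ht htT u v := by
    rw [← Finset.sum_sub_distrib, Finset.sum_mul]
    exact (norm_sum_le _ _).trans (Finset.sum_le_sum fun i hi => (h i hi).lip t ht htT u v)
  cont := continuousOn_finsetSum _ fun i hi => (h i hi).cont
  weight_nonneg t := Finset.sum_nonneg fun i hi => (h i hi).weight_nonneg t
  weight_int := integrable_finsetSum _ fun i hi => (h i hi).weight_int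

end IsSingularKernel

theorem Lp_coeFn_sum {X ι : Type*} [MeasurableSpace X] {μ : Measure X} {r : ℝ≥0∞} (s : Finset ι)
    (f : ι → Lp ℝ r μ) : (∑ i ∈ s, f i : Lp ℝ r μ) =ᵐ[μ] fun x => ∑ i ∈ s, f i x := by
  classical
  induction s using Finset.induction_on with
  | empty => simpa [Pi.zero_def] using Lp.coeFn_zero ℝ r μ
  | insert i s hi ih =>
    rw [Finset.sum_insert hi]
    filter_upwards [ih, Lp.coeFn_add (f i) (∑ i ∈ s, f i)] with x h1 h2
    rw [h2, Pi.add_apply, h1, Finset.sum_insert hi]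

/-- The Duhamel integral in `L^r` is given by pointwise integrals. -/
theorem IsSingularKernel.ae_coeFn_integral {d : ℕ} {r : ℝ≥0∞} [Fact (1 ≤ r)] {T t : ℝ} {w : ℝ → ℝ}
    {Ψ : ℝ → LpV d r → LpV d r} (hΨ : IsSingularKernel T w Ψ) (ht0 : 0 ≤ t) (ht : t ≤ T)
    {U : ℝ → LpV d r} (hU : ContinuousOn U (Set.Icc 0 t))
    {g : ℝ → EuclideanSpace ℝ (Fin d) → ℝ}
    (hg : ContinuousOn (Function.uncurry g) (Set.Ioo 0 t ×ˢ Set.univ))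
    (h : ∀ s ∈ Set.Ioo 0 t, Ψ (t - s) (U s) =ᵐ[volume] g s) :
    ∀ᵐ x, IntervalIntegrable (fun s => g s x) volume 0 t ∧
      (∫ s in (0 : ℝ)..t, Ψ (t - s) (U s) : LpV d r) x = ∫ s in (0 : ℝ)..t, g s x := by
  have h1 := hΨ.intervalIntegrable_sub ht0 ht hU
  rw [intervalIntegrable_iff_integrableOn_Ioo_of_le ht0] at h1
  have h2 : AEStronglyMeasurable (Function.uncurry g)
      ((volume.restrict (Set.Ioo 0 t)).prod (volume : Measure (EuclideanSpace ℝ (Fin d)))) := by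
    rw [← Measure.restrict_univ (μ := (volume : Measure (EuclideanSpace ℝ (Fin d)))),
      Measure.prod_restrict]
    exact hg.aestronglyMeasurable (measurableSet_Ioo.prod MeasurableSet.univ)
  filter_upwards [ae_coeFn_integral_Lp h1 h2
    ((ae_restrict_iff' measurableSet_Ioo).2 (ae_of_all _ h))] with x hx
  rw [intervalIntegral.integral_of_le ht0, intervalIntegral.integral_of_le ht0,
    integral_Ioc_eq_integral_Ioo, integral_Ioc_eq_integral_Ioo,
    intervalIntegrable_iff_integrableOn_Ioo_of_le ht0]
  exact hx

theorem exists_isSingularKernel_propagator (d : ℕ) {r : ℝ≥0∞} [Fact (1 ≤ r)] (hr : r ≠ ∞) (T : ℝ) :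
    ∃ w, IsSingularKernel T w (fun t (u : LpV d r) => propagator t u) := by
  obtain ⟨C, hC0, hC⟩ := exists_norm_propagator_le (r := r) d T
  have hz : ∀ t, propagator t (0 : LpV d r) = 0 := fun t => by
    simpa using propagator_sub hr t (0 : LpV d r) 0
  refine ⟨fun _ => C, fun t _ => hz t, fun t _ htT u v => ?_,
    (continuous_propagator hr).continuousOn, fun _ => hC0, by simp⟩
  rw [← propagator_sub hr]
  refine (hC t htT _).trans (mul_le_mul_of_nonneg_left ?_ hC0)
  exact le_mul_of_one_le_left (norm_nonneg _) (by linarith [norm_nonneg u, norm_nonneg v])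

/-! ### The quadratic term in `L^{2p}` and the condition d < 6p -/

section

variable {d : ℕ} {p : ℝ} [hp : Fact (1 ≤ p)]

instance fact_one_le_ofReal : Fact (1 ≤ ENNReal.ofReal p) := ⟨by simpa using hp.out⟩

instance holderTriple_two_mul :
    ENNReal.HolderTriple (ENNReal.ofReal (2 * p)) (ENNReal.ofReal (2 * p)) (ENNReal.ofReal p) := ⟨by
  have h1 : 0 < p := by linarith [hp.out]
  rw [← ENNReal.ofReal_inv_of_pos (by positivity), ← ENNReal.ofReal_inv_of_pos h1,
    ← ENNReal.ofReal_add (by positivity) (by positivity)]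
  congr 1
  field_simp
  norm_num⟩

/-- The product `L^{2p} × L^{2p} → L^p`. -/
def mulLp : L2p d p →L[ℝ] L2p d p →L[ℝ] LpV d (ENNReal.ofReal p) :=
  (ContinuousLinearMap.mul ℝ ℝ).holderL volume (ENNReal.ofReal (2 * p)) (ENNReal.ofReal (2 * p))
    (ENNReal.ofReal p)

theorem coeFn_mulLp_self (u : L2p d p) : mulLp u u =ᵐ[volume] fun x => u x ^ 2 := by
  filter_upwards [ContinuousLinearMap.coeFn_holder (r := ENNReal.ofReal p)
    (ContinuousLinearMap.mul ℝ ℝ) u u] with x hx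
  rw [sq]
  exact hx

theorem norm_mulLp_self_sub_le (u v : L2p d p) :
    ‖mulLp u u - mulLp v v‖ ≤
      ‖(mulLp : L2p d p →L[ℝ] L2p d p →L[ℝ] LpV d (ENNReal.ofReal p))‖ *
        ((‖u‖ + ‖v‖) * ‖u - v‖) := by
  have h : mulLp u u - mulLp v v = mulLp (u - v) u + mulLp v (u - v) := by
    simp only [map_sub, sub_apply]
    abel
  rw [h]
  refine (norm_add_le _ _).trans ((add_le_add (ContinuousLinearMap.le_opNorm₂ _ _ _)
    (ContinuousLinearMap.le_opNorm₂ _ _ _)).trans (le_of_eq ?_))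
  ring

/-- The bilinear part of the Duhamel kernel. -/
def burgersKernel (l : Fin d) (t : ℝ) (u : L2p d p) : L2p d p :=
  convLp (ENNReal.ofReal (2 * p)) (kernelDerivDiff d l t) (mulLp u u)

variable (p) in
include hp in
-- The conjugate exponent of 2p is the one for which Young's inequality sends L^p, where u² lives,
-- back to L^{2p}.
theorem young_exponents :
    1 ≤ 2 * p / (2 * p - 1) ∧ 1 / (2 * p / (2 * p - 1)) + 1 / p = 1 + 1 / (2 * p) := by
  have h1 : 1 ≤ p := hp.out
  have h2 : 0 < 2 * p - 1 := by linarith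
  refine ⟨by rw [one_le_div h2]; linarith, ?_⟩
  have : 0 < p := by linarith
  field_simp
  ring

theorem coeFn_burgersKernel (l : Fin d) {t : ℝ} (ht : 0 < t) (u : L2p d p) :
    burgersKernel l t u =ᵐ[volume] fun x => ∫ y, kernelDerivDiff d l t (x - y) * mulLp u u y := by
  have hk := isKernelFamily_kernelDerivDiff l
  have h1 : 1 ≤ p := hp.out
  exact coeFn_convLp (young_exponents p).1 h1 (by linarith) (young_exponents p).2
    (hk.continuous ht).measurable (hk.memLp ht (by simpa using (young_exponents p).1)) _

/-- With a conjugate to 2p, d/a - (d + 1) = -1 - d/(2p), so the weight is a multiple of t^{-(1 +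
d/(2p))/4}. The exponent exceeds -1 precisely when d < 6p; this is where that hypothesis enters. The
Lipschitz factor comes from u² - v² = (u - v)u + v(u - v). -/
theorem exists_isSingularKernel_burgersKernel (hdp : (d : ℝ) < 6 * p) (l : Fin d) (T : ℝ) :
    ∃ w, IsSingularKernel T w (burgersKernel (p := p) l) := by
  have hk := isKernelFamily_kernelDerivDiff l
  have h1 : 1 ≤ p := hp.out
  have h2 : 1 ≤ 2 * p := by linarith
  obtain ⟨ha, hab⟩ := young_exponents p
  set a := 2 * p / (2 * p - 1) with had
  obtain ⟨C, hC0, hC⟩ := exists_eLpNorm_kernelDerivDiff_le l ha T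
  set e := (d : ℝ) / a - (d + 1) with he
  have hee : -1 < 1 / 4 * e := by
    have : (d : ℝ) / a = d - d / (2 * p) := by
      rw [had]
      have : 0 < 2 * p - 1 := by linarith
      field_simp
    rw [he, this]
    have : (d : ℝ) / (2 * p) < 3 := by
      rw [div_lt_iff₀ (by linarith)]; linarith
    linarith
  set N := ‖(mulLp : L2p d p →L[ℝ] L2p d p →L[ℝ] LpV d (ENNReal.ofReal p))‖
  have hdiff : ∀ t, 0 < t → ∀ u v : L2p d p, burgersKernel l t u - burgersKernel l t v =
      convLp (ENNReal.ofReal (2 * p)) (kernelDerivDiff d l t)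
        (mulLp u u - mulLp v v : LpV d (ENNReal.ofReal p)) := fun t ht u v =>
    (hk.convLp_sub_right ha h1 h2 hab ht (mulLp u u) (mulLp v v)).symm
  -- The absolute value makes the weight nonnegative also at negative t, where the real power may be
  -- negative.
  refine ⟨fun t => C * (2 * Real.pi) ^ e * N * |t ^ (1 / 4 * e)|, fun t ht => ?_,
    fun t ht htT u v => ?_, ?_, fun t => by positivity, ?_⟩
  · have h3 := norm_convLp_le ha h1 h2 hab (hk.continuous ht).measurable
      (hk.memLp ht (by simpa using ha)) (mulLp (0 : L2p d p) 0)
    rw [map_zero, norm_zero, mul_zero] at h3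
    rw [burgersKernel, map_zero]
    exact norm_le_zero_iff.1 h3
  · rw [hdiff t ht]
    refine (norm_convLp_le ha h1 h2 hab (hk.continuous ht).measurable
      (hk.memLp ht (by simpa using ha)) _).trans ?_
    have h4 : scale t ^ e = (2 * Real.pi) ^ e * |t ^ (1 / 4 * e)| := by
      rw [abs_of_pos (by positivity), scale, Real.mul_rpow (by positivity) (by positivity),
        ← Real.rpow_mul ht.le]
    have h5 := hC t ht htT
    rw [h4] at h5
    calc _ ≤ (C * ((2 * Real.pi) ^ e * |t ^ (1 / 4 * e)|)) * (N * ((‖u‖ + ‖v‖) * ‖u - v‖)) :=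
          mul_le_mul h5 (norm_mulLp_self_sub_le u v) (norm_nonneg _) (by positivity)
      _ = (C * (2 * Real.pi) ^ e * N * |t ^ (1 / 4 * e)|) * ((‖u‖ + ‖v‖) * ‖u - v‖) := by ring
      _ ≤ _ := by
        gcongr
        linarith
  · refine (hk.continuousOn_convLp ha h1 h2 hab).comp
      (f := fun q : ℝ × L2p d p => (q.1, mulLp q.2 q.2)) ?_ fun q hq => ⟨hq.1, trivial⟩
    have : Continuous fun q : ℝ × L2p d p => mulLp q.2 q.2 :=
      (mulLp.continuous.comp continuous_snd).clm_apply continuous_snd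
    exact (continuous_fst.prodMk this).continuousOn
  · have h3 := (intervalIntegral.intervalIntegrable_rpow' (a := 0) (b := T) hee).1.abs
    exact h3.const_mul _

/-- The full Duhamel kernel of the Kuramoto–Sivashinsky–Burgers equation. -/
def duhamelKernel (t : ℝ) (u : L2p d p) : L2p d p :=
  (1 / 2 : ℝ) • propagator t u + (1 / 2 : ℝ) • ∑ l : Fin d, burgersKernel l t u

theorem exists_isSingularKernel_duhamelKernel (hdp : (d : ℝ) < 6 * p) (T : ℝ) :
    ∃ w, IsSingularKernel T w (duhamelKernel (d := d) (p := p)) := by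
  obtain ⟨w₁, h₁⟩ := exists_isSingularKernel_propagator d
    (r := ENNReal.ofReal (2 * p)) ENNReal.ofReal_ne_top T
  choose w₂ h₂ using fun l : Fin d => exists_isSingularKernel_burgersKernel (p := p) hdp l T
  exact ⟨_, (h₁.const_smul (by norm_num)).add
    ((IsSingularKernel.sum Finset.univ fun l _ => h₂ l).const_smul (by norm_num))⟩

/-! ### Equivalence of the pointwise mild formula with the Volterra equation -/

theorem IsKernelFamily.continuousOn_integral_comp {k : ℝ → EuclideanSpace ℝ (Fin d) → ℝ}
    (hk : IsKernelFamily k) {b : ℝ≥0∞} [Fact (1 ≤ b)] {t : ℝ} {f : ℝ → LpV d b}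
    (hf : ContinuousOn f (Set.Ioo 0 t)) :
    ContinuousOn (fun z : ℝ × EuclideanSpace ℝ (Fin d) => ∫ y, k (t - z.1) (z.2 - y) * f z.1 y)
      (Set.Ioo 0 t ×ˢ Set.univ) := by
  refine hk.continuousOn_integral.comp
    (f := fun z : ℝ × EuclideanSpace ℝ (Fin d) => (t - z.1, z.2, f z.1)) ?_
    fun z hz => ⟨sub_pos.2 hz.1.2, trivial⟩
  exact ContinuousOn.prodMk (by fun_prop) (ContinuousOn.prodMk (by fun_prop)
    (hf.comp continuousOn_fst fun z hz => hz.1))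

theorem integrable_lksKernel_mul {t : ℝ} (ht : 0 < t) (u : L2p d p) (x : EuclideanSpace ℝ (Fin d)) :
    Integrable fun y => lksKernel d t x y * u y := by
  simp_rw [lksKernel_eq d ht]
  exact isKernelFamily_kernelDiff.integrable_mul ht x (Lp.memLp u)

theorem lksKernelDeriv_mul_sq_ae {t : ℝ} (ht : 0 < t) (l : Fin d) (u : L2p d p)
    (x : EuclideanSpace ℝ (Fin d)) :
    (fun y => kernelDerivDiff d l t (x - y) * mulLp u u y) =ᵐ[volume]
      fun y => lksKernelDeriv d l t x y * u y ^ 2 := by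
  filter_upwards [coeFn_mulLp_self u] with y hy
  rw [hy, lksKernelDeriv_eq d ht]

theorem integrable_lksKernelDeriv_mul {t : ℝ} (ht : 0 < t) (l : Fin d) (u : L2p d p)
    (x : EuclideanSpace ℝ (Fin d)) :
    Integrable fun y => lksKernelDeriv d l t x y * u y ^ 2 :=
  ((isKernelFamily_kernelDerivDiff l).integrable_mul ht x (Lp.memLp (mulLp u u))).congr
    (lksKernelDeriv_mul_sq_ae ht l u x)

/-- The pointwise Duhamel formula represents the Duhamel formula in `L^{2p}`, and all integrals
in it converge almost everywhere. -/
theorem ae_duhamel (hdp : (d : ℝ) < 6 * p) (u₀ : L2p d p) {t : ℝ} (ht : 0 < t) {U : ℝ → L2p d p}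
    (hU : ContinuousOn U (Set.Icc 0 t)) :
    ∀ᵐ x : EuclideanSpace ℝ (Fin d),
      Integrable (fun y => lksKernel d t x y * u₀ y) ∧
      IteratedIntegrable t (fun s y => lksKernel d (t - s) x y * U s y) ∧
      (∀ l : Fin d,
        IteratedIntegrable t (fun s y => lksKernelDeriv d l (t - s) x y * U s y ^ 2)) ∧
      (propagator t u₀ + ∫ s in (0 : ℝ)..t, duhamelKernel (t - s) (U s) : L2p d p) x =
        (∫ y, lksKernel d t x y * u₀ y)
        + 1 / 2 * (∫ s in (0 : ℝ)..t, ∫ y, lksKernel d (t - s) x y * U s y)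
        + 1 / 2 * ∑ l : Fin d,
          ∫ s in (0 : ℝ)..t, ∫ y, lksKernelDeriv d l (t - s) x y * U s y ^ 2 := by
  have hr : ENNReal.ofReal (2 * p) ≠ ∞ := ENNReal.ofReal_ne_top
  have hUo : ContinuousOn U (Set.Ioo 0 t) := hU.mono Set.Ioo_subset_Icc_self
  have hUsq : ContinuousOn (fun s => mulLp (U s) (U s)) (Set.Ioo 0 t) :=
    (mulLp.continuous.comp_continuousOn hUo).clm_apply hUo
  set g₁ : ℝ → EuclideanSpace ℝ (Fin d) → ℝ := fun s x =>
    ∫ y, lksKernel d (t - s) x y * U s y with hg₁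
  set g₂ : Fin d → ℝ → EuclideanSpace ℝ (Fin d) → ℝ := fun l s x =>
    ∫ y, lksKernelDeriv d l (t - s) x y * U s y ^ 2 with hg₂
  have e₁ : ∀ s ∈ Set.Ioo 0 t, ∀ x, g₁ s x = ∫ y, kernelDiff d (t - s) (x - y) * U s y := by
    intro s hs x
    simp only [hg₁, lksKernel_eq d (sub_pos.2 hs.2)]
  have e₂ : ∀ l, ∀ s ∈ Set.Ioo 0 t, ∀ x, g₂ l s x =
      ∫ y, kernelDerivDiff d l (t - s) (x - y) * mulLp (U s) (U s) y := by
    intro l s hs x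
    exact (integral_congr_ae (lksKernelDeriv_mul_sq_ae (sub_pos.2 hs.2) l (U s) x)).symm
  have c₁ : ContinuousOn (Function.uncurry g₁) (Set.Ioo 0 t ×ˢ Set.univ) :=
    (isKernelFamily_kernelDiff.continuousOn_integral_comp hUo).congr fun z hz => e₁ z.1 hz.1 z.2
  have c₂ : ∀ l, ContinuousOn (Function.uncurry (g₂ l)) (Set.Ioo 0 t ×ˢ Set.univ) := fun l =>
    ((isKernelFamily_kernelDerivDiff l).continuousOn_integral_comp hUsq).congr
      fun z hz => e₂ l z.1 hz.1 z.2
  have a₁ : ∀ s ∈ Set.Ioo 0 t, propagator (t - s) (U s) =ᵐ[volume] g₁ s := fun s hs =>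
    (coeFn_propagator hr (sub_pos.2 hs.2) (U s)).trans (ae_of_all _ fun x => (e₁ s hs x).symm)
  have a₂ : ∀ l, ∀ s ∈ Set.Ioo 0 t, burgersKernel l (t - s) (U s) =ᵐ[volume] g₂ l s :=
    fun l s hs => (coeFn_burgersKernel l (sub_pos.2 hs.2) (U s)).trans
      (ae_of_all _ fun x => (e₂ l s hs x).symm)
  obtain ⟨w, hw⟩ := exists_isSingularKernel_duhamelKernel (p := p) hdp t
  obtain ⟨w₁, hw₁⟩ := exists_isSingularKernel_propagator d hr t
  have b₁ := hw₁.ae_coeFn_integral ht.le le_rfl hU c₁ a₁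
  have b₂ : ∀ᵐ x, ∀ l, IntervalIntegrable (fun s => g₂ l s x) volume 0 t := by
    refine ae_all_iff.2 fun l => ?_
    obtain ⟨w₂, hw₂⟩ := exists_isSingularKernel_burgersKernel (p := p) hdp l t
    exact (hw₂.ae_coeFn_integral ht.le le_rfl hU (c₂ l) (a₂ l)).mono fun x hx => hx.1
  -- The sum is treated as a single kernel; `b₁` and `b₂` supply the integrability in s that allows
  -- its pointwise integral to be split.
  have b := hw.ae_coeFn_integral ht.le le_rfl hU
    (g := fun s x => 1 / 2 * g₁ s x + 1 / 2 * ∑ l, g₂ l s x)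
    ((c₁.const_mul (1 / 2)).add ((continuousOn_finsetSum _ fun l _ => c₂ l).const_mul (1 / 2)))
    (by
      intro s hs
      have a₂' : ∀ᵐ x, ∀ l, burgersKernel l (t - s) (U s) x = g₂ l s x :=
        ae_all_iff.2 fun l => a₂ l s hs
      filter_upwards [a₁ s hs, a₂', Lp_coeFn_sum Finset.univ fun l => burgersKernel l (t - s) (U s),
        Lp.coeFn_smul (1 / 2 : ℝ) (propagator (t - s) (U s)),
        Lp.coeFn_smul (1 / 2 : ℝ) (∑ l : Fin d, burgersKernel l (t - s) (U s)),
        Lp.coeFn_add ((1 / 2 : ℝ) • propagator (t - s) (U s))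
          ((1 / 2 : ℝ) • ∑ l : Fin d, burgersKernel l (t - s) (U s))] with x x1 x2 x3 x4 x5 x6
      rw [duhamelKernel, x6, Pi.add_apply, x4, x5, Pi.smul_apply, Pi.smul_apply, x1, x3]
      simp only [x2, smul_eq_mul])
  filter_upwards [b₁, b₂, b, coeFn_propagator hr ht u₀,
    Lp.coeFn_add (propagator t u₀) (∫ s in (0 : ℝ)..t, duhamelKernel (t - s) (U s))]
    with x x1 x2 x3 x4 x5
  refine ⟨integrable_lksKernel_mul ht u₀ x,
    ⟨fun s hs => integrable_lksKernel_mul (sub_pos.2 hs.2) (U s) x, x1.1⟩,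
    fun l => ⟨fun s hs => integrable_lksKernelDeriv_mul (sub_pos.2 hs.2) l (U s) x, x2 l⟩, ?_⟩
  have hsum : IntervalIntegrable (fun s => ∑ l, g₂ l s x) volume 0 t := by
    simpa only [Finset.sum_fn] using
      IntervalIntegrable.sum Finset.univ (f := fun l s => g₂ l s x) fun l _ => x2 l
  rw [x5, Pi.add_apply, x4, x3.2, intervalIntegral.integral_add (x1.1.const_mul _)
    (hsum.const_mul _), intervalIntegral.integral_const_mul,
    intervalIntegral.integral_const_mul, intervalIntegral.integral_finsetSum fun l _ => x2 l]
  simp only [lksKernel_eq d ht, add_assoc]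
  rfl

/-- `ae_duhamel` assumes only continuity of `U`, not that it solves anything. It therefore serves
both this direction and the converse `IsLKSSolutionOn.volterra`. -/
theorem isLKSSolutionOn_of_volterra (hdp : (d : ℝ) < 6 * p) (u₀ : L2p d p) {τ : ℝ} (hτ : 0 ≤ τ)
    {U : ℝ → L2p d p} (hU : ContinuousOn U (Set.Icc 0 τ))
    (h : ∀ t ∈ Set.Icc 0 τ,
      U t = propagator t u₀ + ∫ s in (0 : ℝ)..t, duhamelKernel (t - s) (U s)) :
    IsLKSSolutionOn (Set.Icc 0 τ) u₀ U where
  continuousOn := hU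
  initial := by
    rw [h 0 ⟨le_rfl, hτ⟩, intervalIntegral.integral_same, add_zero, propagator_zero]
  mild t ht ht0 := by
    filter_upwards [ae_duhamel hdp u₀ ht0 (hU.mono (Set.Icc_subset_Icc_right ht.2))]
      with x hx
    rw [h t ht]
    exact hx

theorem IsLKSSolutionOn.volterra (hdp : (d : ℝ) < 6 * p) {u₀ : L2p d p} {τ : ℝ}
    {U : ℝ → L2p d p} (hU : IsLKSSolutionOn (Set.Icc 0 τ) u₀ U) :
    ∀ t ∈ Set.Icc 0 τ,
      U t = propagator t u₀ + ∫ s in (0 : ℝ)..t, duhamelKernel (t - s) (U s) := by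
  intro t ht
  rcases ht.1.eq_or_lt with rfl | ht0
  · rw [intervalIntegral.integral_same, add_zero, propagator_zero, hU.initial]
  refine Lp.ext ?_
  filter_upwards [hU.mild t ht ht0,
    ae_duhamel hdp u₀ ht0 (hU.continuousOn.mono (Set.Icc_subset_Icc_right ht.2))] with x h1 h2
  rw [h1.2.2.2, h2.2.2.2]

theorem IsLKSSolutionOn.eqOn (hdp : (d : ℝ) < 6 * p) {u₀ : L2p d p} {τ : ℝ}
    {U V : ℝ → L2p d p} (hU : IsLKSSolutionOn (Set.Icc 0 τ) u₀ U)
    (hV : IsLKSSolutionOn (Set.Icc 0 τ) u₀ V) : Set.EqOn U V (Set.Icc 0 τ) := by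
  obtain ⟨w, hw⟩ := exists_isSingularKernel_duhamelKernel (p := p) hdp τ
  exact hw.eqOn_of_volterra (L := fun t => propagator t u₀) hU.continuousOn hV.continuousOn (hU.volterra hdp) (hV.volterra hdp)

theorem exists_isLKSSolutionOn (hdp : (d : ℝ) < 6 * p) {T : ℝ} (hT : 0 < T) (u₀ : L2p d p) :
    ∃ τ, 0 < τ ∧ τ ≤ T ∧ ∃ U : ℝ → L2p d p, IsLKSSolutionOn (Set.Icc 0 τ) u₀ U := by
  obtain ⟨w, hw⟩ := exists_isSingularKernel_duhamelKernel (p := p) hdp T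
  have hL : Continuous fun t => propagator t u₀ :=
    (continuous_propagator (d := d) (r := ENNReal.ofReal (2 * p)) ENNReal.ofReal_ne_top).comp
      (f := fun t => (t, u₀)) (by fun_prop)
  obtain ⟨τ, h0, hT, U, hU, h⟩ := hw.exists_volterra hT hL
  exact ⟨τ, h0, hT, U, isLKSSolutionOn_of_volterra hdp u₀ h0.le hU.continuousOn h⟩

theorem IsLKSSolutionOn.mono {I J : Set ℝ} {u₀ : L2p d p} {U : ℝ → L2p d p}
    (hU : IsLKSSolutionOn I u₀ U) (hJ : J ⊆ I) : IsLKSSolutionOn J u₀ U where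
  continuousOn := hU.continuousOn.mono hJ
  initial := hU.initial
  mild t ht := hU.mild t (hJ ht)

end

end

end KSB

end

theorem mainTheorem1 (d : ℕ) (hd : 0 < d) (p : ℝ) [Fact (1 ≤ p)] (hdp : (d : ℝ) < 6 * p)
    (T : ℝ) (hT : 0 < T) (u₀ : KSB.L2p d p) :
    -- local existence and uniqueness on a closed interval
    (∃ τ : ℝ, 0 < τ ∧ τ ≤ T ∧ ∃ U : ℝ → KSB.L2p d p,
      KSB.IsLKSSolutionOn (Set.Icc 0 τ) u₀ U ∧
      ∀ V : ℝ → KSB.L2p d p, KSB.IsLKSSolutionOn (Set.Icc 0 τ) u₀ V →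
        Set.EqOn V U (Set.Icc 0 τ)) ∧
    -- local existence on a half-open interval
    (∃ τ : ℝ, 0 < τ ∧ τ ≤ T ∧ ∃ U : ℝ → KSB.L2p d p,
      KSB.IsLKSSolutionOn (Set.Ico 0 τ) u₀ U) ∧
    -- uniqueness on the whole interval
    (∀ U₁ U₂ : ℝ → KSB.L2p d p,
      KSB.IsLKSSolutionOn (Set.Icc 0 T) u₀ U₁ → KSB.IsLKSSolutionOn (Set.Icc 0 T) u₀ U₂ →
        Set.EqOn U₁ U₂ (Set.Icc 0 T)) := by
  obtain ⟨τ, h0, hτ, U, hU⟩ := KSB.exists_isLKSSolutionOn hdp hT u₀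
  exact ⟨⟨τ, h0, hτ, U, hU, fun V hV => hV.eqOn hdp hU⟩,
    ⟨τ, h0, hτ, U, hU.mono Set.Ico_subset_Icc_self⟩, fun U₁ U₂ h₁ h₂ => h₁.eqOn hdp h₂⟩
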